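/- Let $n\ge 1$, let $\Sigma$ be a real symmetric positive semidefinite $n\times n$ matrix, $0<\alpha\le\beta$, $\rho>0$, $\varepsilon>0$. Put $\langle X,Y\rangle=\mathrm{Tr}(X^TY)$, $\|\cdot\|_F$ its norm, $$Q_1=\{X\in S^n:\alpha I\preceq X\preceq\beta I\},\qquad Q_2=\{U\in S^n:|U_{ij}|\le 1\},$$ $$\hat f(X)=-\log\det X+\langle\Sigma,X\rangle,\qquad f(X)=\hat f(X)+\rho\sum_{i,j}|X_{ij}|=\hat f(X)+\max_{U\in Q_2}\langle \rho X,U\rangle ,$$ and $\phi(U)=\min_{X\in Q_1}\hat f(X)+\langle\rho X,U\rangle$ (the minimum is attained for $U\in Q_2$). The problem is to minimize $f$ over $Q_1$. Let $d_1(X)=-\log\det X+n\log\beta$, $d_2(U)=\|U\|_F^2/2$, $\sigma_1=1/\beta^2$, $\sigma_2=1$, $M=1/\alpha^2$, $\|A\|=\rho$, $D_1=\max_{Q_1}d_1$, $D_2=\max_{Q_2}d_2$, $\mu=\varepsilon/(2D_2)$, $L=M+2D_2\|A\|^2/(\sigma_2\varepsilon)$, $$f_\varepsilon(X)=\hat f(X)+\max_{U\in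 Q_2}\{\langle\rho X,U\rangle-\mu d_2(U)\}.$$ Then $D_1=n\log(\beta/\alpha)$, $D_2=n^2/2$, $d_1$ is strongly convex on $Q_1$ with parameter $\sigma_1$, $\nabla\hat f=-X^{-1}+\Sigma$ is $M$-Lipschitz on $Q_1$ (Frobenius norm), and on $Q_1$ one has $f_\varepsilon\le f\le f_\varepsilon+\varepsilon/2$ and $\nabla f_\varepsilon$ is $L$-Lipschitz. *Scheme.* Start from $X_0=\beta I$. For $k=0,1,2,\dots$: (1) compute $G_k=\nabla f_\varepsilon(X_k)$ (gradient on $S^n$) and the maximizer $U_k=U^*(X_k)$ in the definition of $f_\varepsilon(X_k)$; (2) $Y_k=\arg\min_{Y\in Q_1}\langle G_k,Y-X_k\rangle+\frac L2\|Y-X_k\|_F^2$; (3) $Z_k=\arg\min_{Z\in Q_1}\frac{L}{\sigma_1}d_1(Z)+\sum_{i=0}^k\frac{i+1}2\left(f_\varepsilon(X_i)+\langle G_i,Z-X_i\rangle\right)$; (4) $X_{k+1}=\frac2{k+3}Z_k+\frac{k+1}{k+3}Y_k$, $\hat U_k=\frac{k\hat U_{k-1}+2U_k}{k+2}$ (so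 $\hat U_0=U_0$); (5) stop as soon as $f(Y_k)-\phi(\hat U_k)\le\varepsilon$. *Cost model.* Exact real arithmetic: each operation $+,-,\times,/,\min,\max,\log$, each comparison, each loading of an integer and each storing of a vector or matrix entry by the program's loops costs one unit (integer counters, indexing and copying are not counted), and one eigenvalue decomposition $B=V\,\mathrm{diag}(\cdot)V^T$ of a symmetric $n\times n$ matrix is a primitive costing $c\,n^3$ units, for a fixed but arbitrary $c\in\mathbb N$. **(i) Explicit steps.** For $X\in Q_1$, $f_\varepsilon(X)=\hat f(X)+\sum_{i,j}\psi(X_{ij})$ with $\psi(x)=\rho|x|-\frac{\varepsilon}{4D_2}$ if $|x|\ge\frac{\varepsilon}{2\rho D_2}$ and $\psi(x)=\frac{D_2\rho^2x^2}{\varepsilon}$ otherwise; the unique maximizer is $U^*(X)=\max(\min(\rho X/\mu,1),-1)$ componentwise; and $\nabla f_\varepsilon(X)=-X^{-1}+\Sigma+\rho U^*(X)$. Step 2 is the projection of $X-L^{-1}G$ on $Q_1$, and the unique projection on $Q_1$ of $B=V\mathrm{diag}(\gamma)V^T$ ($V$ orthogonal) is $V\mathrm{diag}(\min(\max(\gamma_i,\alpha),\beta))V^T$.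 Step 3 has the form $\arg\min_{Z\in Q_1}d_1(Z)+\langle B,Z\rangle$, and for $B=V\mathrm{diag}(s)V^T$ its unique solution is $V\mathrm{diag}(\lambda)V^T$ with $\lambda_i=\min(\max(1/s_i,\alpha),\beta)$ if $s_i>0$ and $\lambda_i=\beta$ if $s_i\le0$. The program that uses these formulas (inverting matrices and evaluating $\log\det$ and $\phi$ through eigenvalue decompositions) runs exactly the above scheme and stopping test, and there is a constant $C_0$ depending only on $c$ such that step 1, step 2, step 3, the evaluation of the duality gap, and a whole iteration each cost at most $C_0n^3$. **(ii) Number of iterations.** Let, with $\kappa=\beta/\alpha$ and $t>0$, $$N_t(\varepsilon)=4\|A\|\frac1\varepsilon\sqrt{\frac{D_1D_2}{\sigma_1\sigma_2}}+t\sqrt{\frac{MD_1}{\sigma_1\varepsilon}}=\frac{\kappa\sqrt{n\log\kappa}}{\varepsilon}\left(2\sqrt2\,n\alpha\rho+t\sqrt\varepsilon\right)\qquad(t=1,\;2\sqrt2).$$ If $k+1\ge N_{2\sqrt2}(\varepsilon)$, or if $\varepsilon\le(n\alpha\rho)^2/2$ and $k+1\ge N_1(\varepsilon)$, then $f(Y_k)-\phi(\hat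 U_k)\le\varepsilon$ and $f(Y_k)\le\min_{Q_1}f+\varepsilon$. Hence the program stops after $T\le\max(1,\lceil N_{2\sqrt2}(\varepsilon)\rceil)$ iterations, and after $T\le\max(1,\lceil N_1(\varepsilon)\rceil)$ iterations if $\varepsilon\le(n\alpha\rho)^2/2$; its output $Y_{T-1}\in Q_1$ satisfies $f(Y_{T-1})\le\min_{Q_1}f+\varepsilon$, and its total cost is at most $C_0n^3T$. **(iii) Total complexity.** For all fixed $\rho>0$, $0<\alpha\le\beta$ and $\varepsilon_0>0$ there is a constant $C$, depending only on these and on $c$, such that for all $n\ge1$, all $\Sigma$ and all $0<\varepsilon\le\varepsilon_0$ the total cost until the program stops is at most $C\,n^{4.5}/\varepsilon$. -/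

import Mathlib

/-!
Sparse maximum likelihood estimation of an inverse covariance matrix: the penalized relaxation
on `{α I ≼ X ≼ β I}`, its smoothing, the accelerated first-order scheme, and an
implementation of the scheme whose elementary operations are counted.
-/

namespace SparseML

/-! ### The optimization problem -/

/-- The data of the problem: a sample covariance matrix `S`, eigenvalue bounds `α, β`, the
penalty `ρ` and the target accuracy `ε`. -/
structure Data (R : Type) (n : ℕ) where
  S : Matrix (Fin n) (Fin n) R
  α : R
  β : R
  ρ : R
  ε : R

/-- Standing assumptions on the data. -/
structure Data.Valid {n : ℕ} (P : Data ℝ n) : Prop where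
  dim_pos : 1 ≤ n
  posSemidef : P.S.PosSemidef
  α_pos : 0 < P.α
  α_le_β : P.α ≤ P.β
  ρ_pos : 0 < P.ρ
  ε_pos : 0 < P.ε

section Problem

variable {n : ℕ}

/-- The Frobenius inner product `⟨X, Y⟩ = Tr(Xᵀ Y)`, as a function of `Y`. -/
noncomputable def frob (X : Matrix (Fin n) (Fin n) ℝ) :
    Matrix (Fin n) (Fin n) ℝ →L[ℝ] ℝ :=
  LinearMap.toContinuousLinearMap
    ((Matrix.traceLinearMap (Fin n) ℝ ℝ).comp (LinearMap.mulLeft ℝ X.transpose))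

/-- The squared Frobenius norm. -/
noncomputable def frobSq (X : Matrix (Fin n) (Fin n) ℝ) : ℝ := frob X X

/-- `Q₁ = {X ∈ Sⁿ : α I ≼ X ≼ β I}` (a positive semidefinite matrix is symmetric here). -/
def Q₁ (P : Data ℝ n) : Set (Matrix (Fin n) (Fin n) ℝ) :=
  {X | (X - P.α • (1 : Matrix (Fin n) (Fin n) ℝ)).PosSemidef ∧
    (P.β • (1 : Matrix (Fin n) (Fin n) ℝ) - X).PosSemidef}

/-- `Q₂ = {U ∈ Sⁿ : |U i j| ≤ 1 for all i, j}`. -/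
def Q₂ (n : ℕ) : Set (Matrix (Fin n) (Fin n) ℝ) :=
  {U | U.IsSymm ∧ ∀ i j, |U i j| ≤ 1}

/-- The smooth part `-log det X + ⟨S, X⟩` of the objective. -/
noncomputable def smoothPart (P : Data ℝ n) (X : Matrix (Fin n) (Fin n) ℝ) : ℝ :=
  -Real.log X.det + frob P.S X

/-- The objective `-log det X + ⟨S, X⟩ + ρ ∑ |X i j|`, to be minimized over `Q₁`. -/
noncomputable def objective (P : Data ℝ n) (X : Matrix (Fin n) (Fin n) ℝ) : ℝ :=
  smoothPart P X + P.ρ * ∑ i, ∑ j, |X i j|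

/-- The adjoint (dual) function `φ(U) = min_{X ∈ Q₁} -log det X + ⟨S, X⟩ + ⟨ρ X, U⟩`. -/
noncomputable def dualFun (P : Data ℝ n) (U : Matrix (Fin n) (Fin n) ℝ) : ℝ :=
  sInf ((fun X => smoothPart P X + P.ρ * frob X U) '' Q₁ P)

/-! ### Prox-functions and parameters -/

/-- The prox-function of `Q₁`, vanishing at its center `β I`. -/
noncomputable def prox₁ (P : Data ℝ n) (X : Matrix (Fin n) (Fin n) ℝ) : ℝ :=
  -Real.log X.det + n * Real.log P.β

/-- The prox-function of `Q₂`. -/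
noncomputable def prox₂ (U : Matrix (Fin n) (Fin n) ℝ) : ℝ := frobSq U / 2

/-- `D₁ = max_{Q₁} prox₁`. -/
noncomputable def D₁ (P : Data ℝ n) : ℝ := sSup (prox₁ P '' Q₁ P)

/-- `D₂ = max_{Q₂} prox₂`. -/
noncomputable def D₂ (n : ℕ) : ℝ := sSup ((prox₂ : Matrix (Fin n) (Fin n) ℝ → ℝ) '' Q₂ n)

/-- Convexity parameter of `prox₁` on `Q₁`. -/
noncomputable def σ₁ (P : Data ℝ n) : ℝ := 1 / P.β ^ 2

/-- Convexity parameter of `prox₂`. -/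
def σ₂ : ℝ := 1

/-- Lipschitz constant of the gradient of `smoothPart` on `Q₁`. -/
noncomputable def lipM (P : Data ℝ n) : ℝ := 1 / P.α ^ 2

/-- Norm of the operator `A = ρ • id`. -/
def normA (P : Data ℝ n) : ℝ := P.ρ

/-- The smoothing parameter `ε / (2 D₂)`. -/
noncomputable def mu (P : Data ℝ n) : ℝ := P.ε / (2 * D₂ n)

/-- Lipschitz constant `M + ‖A‖² / (μ σ₂) = M + 2 D₂ ‖A‖² / (σ₂ ε)` of the smoothed gradient. -/
noncomputable def lipL (P : Data ℝ n) : ℝ :=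
  lipM P + 2 * D₂ n * normA P ^ 2 / (σ₂ * P.ε)

/-- The number `4 ‖A‖ (1/ε) √(D₁ D₂ / (σ₁ σ₂)) + t √(M D₁ / (σ₁ ε))`, where `t` is
the numerical factor of the second term. -/
noncomputable def iterBound (t : ℝ) (P : Data ℝ n) : ℝ :=
  4 * normA P * (1 / P.ε) * √(D₁ P * D₂ n / (σ₁ P * σ₂)) +
    t * √(lipM P * D₁ P / (σ₁ P * P.ε))

/-! ### Smoothing -/

/-- The smoothed objective `f_ε`. -/
noncomputable def smoothed (P : Data ℝ n) (X : Matrix (Fin n) (Fin n) ℝ) : ℝ :=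
  smoothPart P X + sSup ((fun U => P.ρ * frob X U - mu P * prox₂ U) '' Q₂ n)

/-- The Huber-type function that smooths `ρ |x|`. -/
noncomputable def huber (P : Data ℝ n) (x : ℝ) : ℝ :=
  if P.ε / (2 * P.ρ * D₂ n) ≤ |x| then P.ρ * |x| - P.ε / (4 * D₂ n)
  else D₂ n * P.ρ ^ 2 * x ^ 2 / P.ε

/-- Componentwise clipping of `ρ X / μ` to `[-1, 1]`. -/
noncomputable def clipU (P : Data ℝ n) (X : Matrix (Fin n) (Fin n) ℝ) :
    Matrix (Fin n) (Fin n) ℝ :=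
  Matrix.of fun i j => max (min (P.ρ * X i j / mu P) 1) (-1)

/-- The closed form `-X⁻¹ + S + ρ U*(X)` of the smoothed gradient. -/
noncomputable def gradForm (P : Data ℝ n) (X : Matrix (Fin n) (Fin n) ℝ) :
    Matrix (Fin n) (Fin n) ℝ :=
  -X⁻¹ + P.S + P.ρ • clipU P X

/-- `G ∈ Sⁿ` is the gradient at `X`, for the Frobenius inner product, of `f` as a function on the
space `Sⁿ` of symmetric matrices. -/
def HasGradOnSymm (f : Matrix (Fin n) (Fin n) ℝ → ℝ) (G X : Matrix (Fin n) (Fin n) ℝ) : Prop :=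
  G.IsSymm ∧ HasFDerivWithinAt f (frob G) {Y | Y.IsSymm} X

/-- `x` is the unique minimizer of `f` over `s`. -/
def IsUniqueMinOn {E : Type} (f : E → ℝ) (s : Set E) (x : E) : Prop :=
  x ∈ s ∧ ∀ y ∈ s, y ≠ x → f x < f y

/-- `V` is orthogonal and `B = V diag(d) Vᵀ`. -/
def IsEigenDecomp (B V : Matrix (Fin n) (Fin n) ℝ) (d : Fin n → ℝ) : Prop :=
  V * V.transpose = 1 ∧ V.transpose * V = 1 ∧ B = V * Matrix.diagonal d * V.transpose

/-- Clipping of an eigenvalue in the projection step. -/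
noncomputable def clipEig (P : Data ℝ n) (t : ℝ) : ℝ := min (max t P.α) P.β

/-- Clipping of `1 / t` in the prox step, with `1 / t` read as `+∞` for `t ≤ 0`. -/
noncomputable def clipInv (P : Data ℝ n) (t : ℝ) : ℝ :=
  if t ≤ 0 then P.β else min (max (1 / t) P.α) P.β

/-- The objective of the gradient step at `X` with gradient `G`. -/
noncomputable def stepObj (P : Data ℝ n) (G X Y : Matrix (Fin n) (Fin n) ℝ) : ℝ :=
  frob G (Y - X) + lipL P / 2 * frobSq (Y - X)

/-- The objective of the estimate-sequence step after the query points `X 0, …, X k`. -/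
noncomputable def estimateObj (P : Data ℝ n) (X G : ℕ → Matrix (Fin n) (Fin n) ℝ) (k : ℕ)
    (Z : Matrix (Fin n) (Fin n) ℝ) : ℝ :=
  lipL P * prox₁ P Z / σ₁ P +
    ∑ i ∈ Finset.range (k + 1), ((i : ℝ) + 1) / 2 * (smoothed P (X i) + frob (G i) (Z - X i))

/-- The sequences `X, G, U, Y, Z, Uh` follow the accelerated scheme for the smoothed problem:
query points, gradients, maximizers `U*(X k)`, primal iterates, estimate-sequence minimizers and
dual iterates. -/
structure IsScheme (P : Data ℝ n) (X G U Y Z Uh : ℕ → Matrix (Fin n) (Fin n) ℝ) : Prop where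
  start : X 0 = P.β • (1 : Matrix (Fin n) (Fin n) ℝ)
  grad : ∀ k, HasGradOnSymm (smoothed P) (G k) (X k)
  argmax_mem : ∀ k, U k ∈ Q₂ n
  argmax : ∀ k, IsMaxOn (fun V => P.ρ * frob (X k) V - mu P * prox₂ V) (Q₂ n) (U k)
  primal_mem : ∀ k, Y k ∈ Q₁ P
  primal : ∀ k, IsMinOn (stepObj P (G k) (X k)) (Q₁ P) (Y k)
  estimate_mem : ∀ k, Z k ∈ Q₁ P
  estimate : ∀ k, IsMinOn (estimateObj P X G k) (Q₁ P) (Z k)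
  update : ∀ k, X (k + 1) = (2 / ((k : ℝ) + 3)) • Z k + (((k : ℝ) + 1) / (k + 3)) • Y k
  dual_zero : Uh 0 = U 0
  dual_succ : ∀ k, Uh (k + 1) =
    (1 / ((k : ℝ) + 3)) • (((k : ℝ) + 1) • Uh k + (2 : ℝ) • U (k + 1))

end Problem

/-! ### Counting operations -/

/-- A value together with the number of elementary operations spent on it. -/
structure Costed (A : Type) where
  val : A
  cost : ℕ

instance : Monad Costed where
  pure a := ⟨a, 0⟩
  bind x f := ⟨(f x.val).val, x.cost + (f x.val).cost⟩

/-- The elementary operations on scalars of type `R`. Programs below are written for an arbitrary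
scalar type, so that these operations are their only access to scalars. -/
structure Machine (R : Type) where
  nat : ℕ → Costed R
  add : R → R → Costed R
  sub : R → R → Costed R
  mul : R → R → Costed R
  div : R → R → Costed R
  min : R → R → Costed R
  max : R → R → Costed R
  log : R → Costed R
  le : R → R → Costed Bool
  eig : (n : ℕ) → Matrix (Fin n) (Fin n) R → Costed ((Fin n → R) × Matrix (Fin n) (Fin n) R)

open Classical in
/-- Eigenvalues and an orthogonal matrix whose columns are eigenvectors of a symmetric matrix. -/
noncomputable def eigReal (n : ℕ) (B : Matrix (Fin n) (Fin n) ℝ) :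
    (Fin n → ℝ) × Matrix (Fin n) (Fin n) ℝ :=
  if h : B.IsHermitian then (h.eigenvalues, (h.eigenvectorUnitary : Matrix (Fin n) (Fin n) ℝ))
  else (0, 1)

open Classical in
/-- Exact real arithmetic: scalar operations cost one unit, and one eigenvalue decomposition of a
symmetric `n × n` matrix costs `c n³` units. -/
noncomputable def realMachine (c : ℕ) : Machine ℝ where
  nat k := ⟨(k : ℝ), 1⟩
  add x y := ⟨x + y, 1⟩
  sub x y := ⟨x - y, 1⟩
  mul x y := ⟨x * y, 1⟩
  div x y := ⟨x / y, 1⟩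
  min x y := ⟨Min.min x y, 1⟩
  max x y := ⟨Max.max x y, 1⟩
  log x := ⟨Real.log x, 1⟩
  le x y := ⟨decide (x ≤ y), 1⟩
  eig n B := ⟨eigReal n B, c * n ^ 3⟩

/-- Fill a vector entry by entry; storing an entry costs one unit. -/
def vecC {A : Type} {n : ℕ} (f : Fin n → Costed A) : Costed (Fin n → A) :=
  ⟨fun i => (f i).val, ∑ i, ((f i).cost + 1)⟩

/-- Fill a matrix entry by entry; storing an entry costs one unit. -/
def matC {A : Type} {n : ℕ} (f : Fin n → Fin n → Costed A) : Costed (Matrix (Fin n) (Fin n) A) :=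
  ⟨Matrix.of fun i j => (f i j).val, ∑ i, ∑ j, ((f i j).cost + 1)⟩

section Programs

variable {R : Type} {n : ℕ}

/-- Summation by successive additions. -/
def sumC (M : Machine R) : {m : ℕ} → (Fin m → Costed R) → Costed R
  | 0, _ => M.nat 0
  | _ + 1, f => do
    let s ← sumC M (fun i => f i.castSucc)
    let x ← f (Fin.last _)
    M.add s x

/-- `V diag(d) Vᵀ`. -/
def spectralC (M : Machine R) (V : Matrix (Fin n) (Fin n) R) (d : Fin n → R) :
    Costed (Matrix (Fin n) (Fin n) R) :=
  matC fun i j => sumC M fun l => do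
    let a ← M.mul (V i l) (d l)
    M.mul a (V j l)

/-- Inner product of two symmetric matrices. -/
def innerC (M : Machine R) (A B : Matrix (Fin n) (Fin n) R) : Costed R :=
  sumC M fun i => sumC M fun j => M.mul (A i j) (B i j)

/-- Inverse of a symmetric matrix. -/
def invC (M : Machine R) (X : Matrix (Fin n) (Fin n) R) : Costed (Matrix (Fin n) (Fin n) R) := do
  let e ← M.eig n X
  let one ← M.nat 1
  let d ← vecC fun i => M.div one (e.1 i)
  spectralC M e.2 d

/-- Logarithm of the determinant of a positive definite matrix. -/
def logDetC (M : Machine R) (X : Matrix (Fin n) (Fin n) R) : Costed R := do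
  let e ← M.eig n X
  sumC M fun i => M.log (e.1 i)

/-- `D₂ = n² / 2`. -/
def d2C (M : Machine R) (n : ℕ) : Costed R := do
  let m ← M.nat n
  let m2 ← M.mul m m
  let two ← M.nat 2
  M.div m2 two

/-- `μ = ε / (2 D₂)`. -/
def muC (M : Machine R) (P : Data R n) : Costed R := do
  let d ← d2C M n
  let two ← M.nat 2
  let e ← M.mul two d
  M.div P.ε e

/-- `L = 1 / α² + 2 D₂ ρ² / ε`. -/
def lipC (M : Machine R) (P : Data R n) : Costed R := do
  let one ← M.nat 1
  let two ← M.nat 2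
  let a2 ← M.mul P.α P.α
  let m ← M.div one a2
  let d ← d2C M n
  let x ← M.mul two d
  let r2 ← M.mul P.ρ P.ρ
  let y ← M.mul x r2
  let z ← M.div y P.ε
  M.add m z

/-- `U*(X)`: componentwise clipping. -/
def clipC (M : Machine R) (P : Data R n) (X : Matrix (Fin n) (Fin n) R) :
    Costed (Matrix (Fin n) (Fin n) R) := do
  let mu ← muC M P
  let one ← M.nat 1
  let zero ← M.nat 0
  let neg ← M.sub zero one
  matC fun i j => do
    let a ← M.mul P.ρ (X i j)
    let b ← M.div a mu
    let t ← M.min b one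
    M.max t neg

/-- Step 1: the smoothed gradient `-X⁻¹ + S + ρ U*(X)`, together with `U*(X)`. -/
def step1C (M : Machine R) (P : Data R n) (X : Matrix (Fin n) (Fin n) R) :
    Costed (Matrix (Fin n) (Fin n) R × Matrix (Fin n) (Fin n) R) := do
  let U ← clipC M P X
  let W ← invC M X
  let G ← matC fun i j => do
    let a ← M.sub (P.S i j) (W i j)
    let b ← M.mul P.ρ (U i j)
    M.add a b
  return (G, U)

/-- Projection on `Q₁` by clipping eigenvalues. -/
def projC (M : Machine R) (P : Data R n) (B : Matrix (Fin n) (Fin n) R) :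
    Costed (Matrix (Fin n) (Fin n) R) := do
  let e ← M.eig n B
  let d ← vecC fun i => do
    let t ← M.max (e.1 i) P.α
    M.min t P.β
  spectralC M e.2 d

/-- Step 2: projection of `X - L⁻¹ G` on `Q₁`. -/
def step2C (M : Machine R) (P : Data R n) (X G : Matrix (Fin n) (Fin n) R) :
    Costed (Matrix (Fin n) (Fin n) R) := do
  let L ← lipC M P
  let B ← matC fun i j => do
    let a ← M.div (G i j) L
    M.sub (X i j) a
  projC M P B

/-- Minimizer of `-log det X + ⟨B, X⟩` over `Q₁`, by clipping inverse eigenvalues. -/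
def proxC (M : Machine R) (P : Data R n) (B : Matrix (Fin n) (Fin n) R) :
    Costed (Matrix (Fin n) (Fin n) R) := do
  let e ← M.eig n B
  let zero ← M.nat 0
  let one ← M.nat 1
  let d ← vecC fun i => do
    let b ← M.le (e.1 i) zero
    if b then pure P.β
    else do
      let r ← M.div one (e.1 i)
      let t ← M.max r P.α
      M.min t P.β
  spectralC M e.2 d

/-- Step 3: the prox step for the weighted sum `W` of gradients, i.e. for `(σ₁ / L) W`. -/
def step3C (M : Machine R) (P : Data R n) (W : Matrix (Fin n) (Fin n) R) :
    Costed (Matrix (Fin n) (Fin n) R) := do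
  let L ← lipC M P
  let b2 ← M.mul P.β P.β
  let t ← M.mul b2 L
  let B ← matC fun i j => M.div (W i j) t
  proxC M P B

/-- The dual function at `U`. -/
def dualC (M : Machine R) (P : Data R n) (U : Matrix (Fin n) (Fin n) R) : Costed R := do
  let B ← matC fun i j => do
    let a ← M.mul P.ρ (U i j)
    M.add (P.S i j) a
  let X ← proxC M P B
  let l ← logDetC M X
  let s ← innerC M B X
  M.sub s l

/-- The objective at `Y`. -/
def objC (M : Machine R) (P : Data R n) (Y : Matrix (Fin n) (Fin n) R) : Costed R := do
  let l ← logDetC M Y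
  let s ← innerC M P.S Y
  let zero ← M.nat 0
  let a ← sumC M fun i => sumC M fun j => do
    let y ← M.sub zero (Y i j)
    M.max (Y i j) y
  let b ← M.mul P.ρ a
  let t ← M.sub s l
  M.add t b

/-- The duality gap at `(Y, U)`. -/
def gapC (M : Machine R) (P : Data R n) (Y U : Matrix (Fin n) (Fin n) R) : Costed R := do
  let a ← objC M P Y
  let b ← dualC M P U
  M.sub a b

/-- The memory between two iterations: the next query point `X`, the weighted sum `W` of the
gradients, the last `G, U, Y, Z`, the dual iterate `Uh`, and the outcome of the stopping test. -/
structure State (R : Type) (n : ℕ) where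
  X : Matrix (Fin n) (Fin n) R
  W : Matrix (Fin n) (Fin n) R
  G : Matrix (Fin n) (Fin n) R
  U : Matrix (Fin n) (Fin n) R
  Y : Matrix (Fin n) (Fin n) R
  Z : Matrix (Fin n) (Fin n) R
  Uh : Matrix (Fin n) (Fin n) R
  done : Bool

/-- `X₀ = β I`; the other variables start at zero. -/
def initC (M : Machine R) (P : Data R n) : Costed (State R n) := do
  let zero ← M.nat 0
  let X ← matC fun i j => if i = j then pure P.β else pure zero
  let W ← matC fun _ _ => pure zero
  let Uh ← matC fun _ _ => pure zero
  return ⟨X, W, W, W, W, W, Uh, false⟩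

/-- Iteration number `k` (starting from `0`), with the evaluation of the stopping test. -/
def iterC (M : Machine R) (P : Data R n) (k : ℕ) (s : State R n) : Costed (State R n) := do
  let GU ← step1C M P s.X
  let Y ← step2C M P s.X GU.1
  let kk ← M.nat k
  let one ← M.nat 1
  let two ← M.nat 2
  let three ← M.nat 3
  let k1 ← M.add kk one
  let k2 ← M.add kk two
  let k3 ← M.add kk three
  let w ← M.div k1 two
  let W ← matC fun i j => do
    let a ← M.mul w (GU.1 i j)
    M.add (s.W i j) a
  let Z ← step3C M P W
  let p ← M.div two k3
  let q ← M.div k1 k3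
  let X ← matC fun i j => do
    let a ← M.mul p (Z i j)
    let b ← M.mul q (Y i j)
    M.add a b
  let Uh ← matC fun i j => do
    let a ← M.mul kk (s.Uh i j)
    let b ← M.mul two (GU.2 i j)
    let t ← M.add a b
    M.div t k2
  let g ← gapC M P Y Uh
  let b ← M.le g P.ε
  return ⟨X, W, GU.1, GU.2, Y, Z, Uh, b⟩

/-- The first `m` iterations. -/
def runC (M : Machine R) (P : Data R n) : ℕ → Costed (State R n)
  | 0 => initC M P
  | m + 1 => do
    let s ← runC M P m
    iterC M P m s

/-- The algorithm stops after exactly `T` iterations: the test succeeds for the first time. -/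
def StopsAfter (M : Machine R) (P : Data R n) (T : ℕ) : Prop :=
  (runC M P T).val.done = true ∧ ∀ m < T, (runC M P m).val.done = false

end Programs

end SparseML

open SparseML

/-!
The smoothed accelerated scheme for sparse maximum likelihood, its iteration count and its cost.

*Spectral comparison.* If `A = V diag(a) Vᵀ` and `B = W diag(b) Wᵀ` with orthogonal `V, W`, then
`⟨A, B⟩ = ∑ i j, w i j * a i * b j` with the doubly stochastic weights `w i j = (Vᵀ W) i j ^ 2`
(`frob_spectral`). Hence Frobenius distances, log-determinants and traces of products of functions
of `A` and `B` are all averages over the same weights, and a matrix inequality follows from the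
scalar inequality between eigenvalues. The strong convexity and the smoothness of `-log det` on `Q₁`
(`neg_log_det_lower`, `neg_log_det_upper`), the Lipschitz continuity of the inverse
(`frobSq_inv_sub_inv_le`), the projection formula (`isUniqueMinOn_proj`) and the solution of the
prox step together with its quadratic growth (`prox_growth`) are obtained in this way. Gradients
need no matrix calculus: the lower and upper quadratic bounds enclose the function between its
linearization and a quadratic error (`hasGradOnSymm_of_quadratic_error`).

*Smoothing.* The inner maximization problem separates into coordinates, and its quadratic growth at
the clipped matrix `U*(X)` (`clipU_optimal`) gives the formula, the convexity and the smoothness of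
the smoothed penalty.

*Iterations.* With `A_k = (k + 1) (k + 2) / 4`, induction on `k` shows that `A_k f_ε(Y_k)` is at
most the minimum of the estimate function (`IsScheme.estimate_sequence`). The linearizations of
`f_ε` at `X_i` lie below the Lagrangian at `U_i`, so that the estimate function at the minimizer defining
`φ(Uh_k)` is at most `L D₁ / σ₁ + A_k φ(Uh_k)` (`IsScheme.smoothed_gap`). The smoothing error
`ε / 2` and `(k + 1)² ≥ 8 L D₁ / (σ₁ ε)` then bound the duality gap by `ε`. Here
`8 L D₁ / (σ₁ ε) = a² + 8 b²` if the iteration bound is `a + t b`, and this is at most `(a + t b)²`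
for `t = 2 √2`, and also for `t = 1` if `4 b ≤ a` (`lipL_le_of_iterBound_le`).

*Program.* The values of the subprograms are the explicit formulas above, so that the states of the
program form an instance of the scheme (`isScheme_runState`). Each subprogram uses boundedly many
eigenvalue decompositions and `O(n³)` further operations, whatever its input (`iterC_cost`).
-/

namespace SparseML

/-! ### Spectral calculus for the Frobenius inner product -/

section Spectral

variable {n : ℕ}

lemma frob_apply (X Y : Matrix (Fin n) (Fin n) ℝ) : frob X Y = ∑ i, ∑ j, X i j * Y i j := by
  simp only [frob, LinearMap.coe_toContinuousLinearMap', LinearMap.comp_apply,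
    LinearMap.mulLeft_apply, Matrix.traceLinearMap_apply, Matrix.trace, Matrix.diag_apply,
    Matrix.mul_apply, Matrix.transpose_apply]
  exact Finset.sum_comm

lemma frob_comm (X Y : Matrix (Fin n) (Fin n) ℝ) : frob X Y = frob Y X := by
  simp only [frob_apply, mul_comm]

lemma frobSq_apply (X : Matrix (Fin n) (Fin n) ℝ) : frobSq X = ∑ i, ∑ j, X i j ^ 2 := by
  simp only [frobSq, frob_apply, sq]

lemma frob_add_left (X X' Y : Matrix (Fin n) (Fin n) ℝ) :
    frob (X + X') Y = frob X Y + frob X' Y := by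
  rw [frob_comm, map_add, frob_comm Y, frob_comm Y]

lemma frob_sub_left (X X' Y : Matrix (Fin n) (Fin n) ℝ) :
    frob (X - X') Y = frob X Y - frob X' Y := by
  rw [frob_comm, map_sub, frob_comm Y, frob_comm Y]

lemma frob_smul_left (t : ℝ) (X Y : Matrix (Fin n) (Fin n) ℝ) :
    frob (t • X) Y = t * frob X Y := by
  rw [frob_comm, map_smul, frob_comm Y, smul_eq_mul]

lemma frob_neg_left (X Y : Matrix (Fin n) (Fin n) ℝ) : frob (-X) Y = -frob X Y := by
  rw [frob_comm, map_neg, frob_comm Y]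

lemma frob_smul_right (t : ℝ) (X Y : Matrix (Fin n) (Fin n) ℝ) :
    frob X (t • Y) = t * frob X Y := by
  rw [map_smul, smul_eq_mul]

lemma frobSq_nonneg (X : Matrix (Fin n) (Fin n) ℝ) : 0 ≤ frobSq X := by
  rw [frobSq_apply]; positivity

lemma frobSq_smul (t : ℝ) (X : Matrix (Fin n) (Fin n) ℝ) :
    frobSq (t • X) = t ^ 2 * frobSq X := by
  rw [frobSq, frob_smul_left, frob_smul_right, frobSq]; ring

lemma frobSq_sub (X Y : Matrix (Fin n) (Fin n) ℝ) :
    frobSq (X - Y) = frobSq X - 2 * frob X Y + frobSq Y := by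
  simp only [frobSq, frob_sub_left, map_sub, frob_comm Y X]; ring

lemma frobSq_sub_comm (X Y : Matrix (Fin n) (Fin n) ℝ) : frobSq (X - Y) = frobSq (Y - X) := by
  rw [frobSq_sub, frobSq_sub, frob_comm X Y]; ring

lemma frobSq_pos_of_ne {X Y : Matrix (Fin n) (Fin n) ℝ} (h : X ≠ Y) : 0 < frobSq (X - Y) := by
  refine lt_of_le_of_ne (frobSq_nonneg _) fun h0 => h ?_
  rw [frobSq_apply] at h0
  ext i j
  have h1 := (Finset.sum_eq_zero_iff_of_nonneg (fun i _ => by positivity)).1 h0.symm i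
    (Finset.mem_univ i)
  have h2 := (Finset.sum_eq_zero_iff_of_nonneg (fun i _ => by positivity)).1 h1 j
    (Finset.mem_univ j)
  have h3 : X i j - Y i j = 0 := by simpa using h2
  linarith

lemma frob_le_frobSq (X Y : Matrix (Fin n) (Fin n) ℝ) : 2 * frob X Y ≤ frobSq X + frobSq Y := by
  have := frobSq_nonneg (X - Y)
  rw [frobSq_sub] at this
  linarith

/-- The squared inner products of the columns of `V` with those of `W`: for orthogonal `V, W` a
doubly stochastic matrix. -/
def overlap (V W : Matrix (Fin n) (Fin n) ℝ) (i j : Fin n) : ℝ := (V.transpose * W) i j ^ 2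

lemma overlap_nonneg (V W : Matrix (Fin n) (Fin n) ℝ) (i j : Fin n) : 0 ≤ overlap V W i j :=
  sq_nonneg _

lemma overlap_comm (V W : Matrix (Fin n) (Fin n) ℝ) (i j : Fin n) :
    overlap V W i j = overlap W V j i := by
  have : V.transpose * W = (W.transpose * V).transpose := by simp
  rw [overlap, this, Matrix.transpose_apply, overlap]

lemma sum_overlap_right {V W : Matrix (Fin n) (Fin n) ℝ} (hV : V.transpose * V = 1)
    (hW : W * W.transpose = 1) (i : Fin n) : ∑ j, overlap V W i j = 1 := by
  have h : (V.transpose * W) * (V.transpose * W).transpose = 1 := by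
    rw [Matrix.transpose_mul, Matrix.transpose_transpose, Matrix.mul_assoc,
      ← Matrix.mul_assoc W, hW, Matrix.one_mul, hV]
  have h2 := congrFun (congrFun h i) i
  rw [Matrix.mul_apply, Matrix.one_apply_eq] at h2
  simpa only [Matrix.transpose_apply, ← sq, overlap] using h2

lemma sum_overlap_left {V W : Matrix (Fin n) (Fin n) ℝ} (hV : V * V.transpose = 1)
    (hW : W.transpose * W = 1) (j : Fin n) : ∑ i, overlap V W i j = 1 := by
  simp only [overlap_comm V W]
  exact sum_overlap_right hW hV j

/-- The Frobenius inner product of two symmetric matrices is the average of the products of their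
eigenvalues with respect to the overlap of the eigenbases. -/
lemma frob_spectral {A B V W : Matrix (Fin n) (Fin n) ℝ} {a b : Fin n → ℝ}
    (hA : IsEigenDecomp A V a) (hB : IsEigenDecomp B W b) :
    frob A B = ∑ i, ∑ j, overlap V W i j * (a i * b j) := by
  obtain ⟨-, -, rfl⟩ := hA
  obtain ⟨-, -, rfl⟩ := hB
  have h : frob (V * Matrix.diagonal a * V.transpose) (W * Matrix.diagonal b * W.transpose) =
      Matrix.trace ((Matrix.diagonal a * (V.transpose * W)) *
        (Matrix.diagonal b * (V.transpose * W).transpose)) := by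
    simp only [frob, LinearMap.coe_toContinuousLinearMap', LinearMap.comp_apply,
      LinearMap.mulLeft_apply, Matrix.traceLinearMap_apply, Matrix.transpose_mul,
      Matrix.transpose_transpose, Matrix.diagonal_transpose]
    rw [Matrix.mul_assoc V, Matrix.trace_mul_comm]
    simp only [Matrix.mul_assoc]
  rw [h, Matrix.trace]
  refine Finset.sum_congr rfl fun i _ => ?_
  rw [Matrix.diag_apply, Matrix.mul_apply]
  refine Finset.sum_congr rfl fun j _ => ?_
  rw [Matrix.diagonal_mul, Matrix.diagonal_mul, Matrix.transpose_apply, overlap]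
  ring

section Decomp

variable {A B V W : Matrix (Fin n) (Fin n) ℝ} {a b : Fin n → ℝ}

lemma IsEigenDecomp.map (hA : IsEigenDecomp A V a) (f : ℝ → ℝ) :
    IsEigenDecomp (V * Matrix.diagonal (fun i => f (a i)) * V.transpose) V (fun i => f (a i)) :=
  ⟨hA.1, hA.2.1, rfl⟩

lemma IsEigenDecomp.sum_left (hA : IsEigenDecomp A V a) (hB : IsEigenDecomp B W b)
    (f : Fin n → ℝ) : ∑ i, f i = ∑ i, ∑ j, overlap V W i j * f i := by
  simp only [← Finset.sum_mul, sum_overlap_right hA.2.1 hB.1, one_mul]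

lemma IsEigenDecomp.sum_right (hA : IsEigenDecomp A V a) (hB : IsEigenDecomp B W b)
    (f : Fin n → ℝ) : ∑ j, f j = ∑ i, ∑ j, overlap V W i j * f j := by
  rw [Finset.sum_comm]
  simp only [← Finset.sum_mul, sum_overlap_left hA.1 hB.2.1, one_mul]

lemma frob_spectral_same (hA : IsEigenDecomp A V a) (hB : IsEigenDecomp B V b) :
    frob A B = ∑ i, a i * b i := by
  rw [frob_spectral hA hB]
  refine Finset.sum_congr rfl fun i _ => ?_
  rw [Finset.sum_eq_single i]
  · simp [overlap, hA.2.1]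
  · intro j _ hj
    simp [overlap, hA.2.1, Matrix.one_apply_ne hj.symm]
  · simp

lemma IsEigenDecomp.frobSq_eq (hA : IsEigenDecomp A V a) : frobSq A = ∑ i, a i ^ 2 := by
  simp only [frobSq, frob_spectral_same hA hA, sq]

lemma frobSq_sub_spectral (hA : IsEigenDecomp A V a) (hB : IsEigenDecomp B W b) :
    frobSq (A - B) = ∑ i, ∑ j, overlap V W i j * (a i - b j) ^ 2 := by
  rw [frobSq_sub, hA.frobSq_eq, hB.frobSq_eq, frob_spectral hA hB, hA.sum_left hB,
    hA.sum_right hB (fun j => b j ^ 2)]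
  simp only [Finset.mul_sum, ← Finset.sum_add_distrib, ← Finset.sum_sub_distrib]
  exact Finset.sum_congr rfl fun i _ => Finset.sum_congr rfl fun j _ => by ring

lemma IsEigenDecomp.det_eq (hA : IsEigenDecomp A V a) : A.det = ∏ i, a i := by
  obtain ⟨h1, -, rfl⟩ := hA
  rw [Matrix.det_mul_right_comm, h1, Matrix.one_mul, Matrix.det_diagonal]

lemma IsEigenDecomp.log_det (hA : IsEigenDecomp A V a) (h : ∀ i, 0 < a i) :
    Real.log A.det = ∑ i, Real.log (a i) := by
  rw [hA.det_eq, Real.log_prod fun i _ => (h i).ne']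

lemma IsEigenDecomp.inv (hA : IsEigenDecomp A V a) (h : ∀ i, a i ≠ 0) :
    IsEigenDecomp A⁻¹ V (fun i => (a i)⁻¹) := by
  refine ⟨hA.1, hA.2.1, ?_⟩
  obtain ⟨h1, h2, rfl⟩ := hA
  refine Matrix.inv_eq_right_inv ?_
  calc V * Matrix.diagonal a * V.transpose * (V * Matrix.diagonal (fun i => (a i)⁻¹) * V.transpose)
      = V * Matrix.diagonal a * (V.transpose * V) *
          Matrix.diagonal (fun i => (a i)⁻¹) * V.transpose := by simp only [Matrix.mul_assoc]
    _ = V * (Matrix.diagonal a * Matrix.diagonal (fun i => (a i)⁻¹)) * V.transpose := by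
        rw [h2, Matrix.mul_one, Matrix.mul_assoc V]
    _ = 1 := by
        rw [Matrix.diagonal_mul_diagonal]
        simp [h, h1]

lemma IsEigenDecomp.posSemidef_iff (hA : IsEigenDecomp A V a) : A.PosSemidef ↔ ∀ i, 0 ≤ a i := by
  obtain ⟨h1, h2, rfl⟩ := hA
  rw [← Matrix.posSemidef_diagonal_iff]
  constructor
  · intro h
    have := h.mul_mul_conjTranspose_same V.transpose
    rw [Matrix.conjTranspose_eq_transpose_of_trivial, Matrix.transpose_transpose] at this
    convert this using 1
    rw [Matrix.mul_assoc, Matrix.mul_assoc, h2, Matrix.mul_one, ← Matrix.mul_assoc, h2,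
      Matrix.one_mul]
  · intro h
    simpa using h.mul_mul_conjTranspose_same V

lemma IsEigenDecomp.sub_smul_one (hA : IsEigenDecomp A V a) (t : ℝ) :
    IsEigenDecomp (A - t • (1 : Matrix (Fin n) (Fin n) ℝ)) V (fun i => a i - t) := by
  refine ⟨hA.1, hA.2.1, ?_⟩
  have h : Matrix.diagonal (fun i => a i - t) =
      Matrix.diagonal a - t • (1 : Matrix (Fin n) (Fin n) ℝ) := by
    ext i j
    by_cases hij : i = j <;> simp [hij]
  rw [h, Matrix.mul_sub, Matrix.sub_mul, ← hA.2.2, Matrix.mul_smul, Matrix.mul_one,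
    Matrix.smul_mul, hA.1]

lemma IsEigenDecomp.neg (hA : IsEigenDecomp A V a) : IsEigenDecomp (-A) V (fun i => -a i) := by
  refine ⟨hA.1, hA.2.1, ?_⟩
  have h : Matrix.diagonal (fun i => -a i) = -Matrix.diagonal a := by
    ext i j
    by_cases hij : i = j <;> simp [hij]
  rw [h, Matrix.mul_neg, Matrix.neg_mul, ← hA.2.2]

lemma IsEigenDecomp.mem_Q₁_iff (P : Data ℝ n) (hA : IsEigenDecomp A V a) :
    A ∈ Q₁ P ↔ ∀ i, P.α ≤ a i ∧ a i ≤ P.β := by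
  have h1 := (hA.sub_smul_one P.α).posSemidef_iff
  have h2 := (hA.sub_smul_one P.β).neg.posSemidef_iff
  rw [neg_sub] at h2
  rw [Q₁, Set.mem_ofPred_eq, h1, h2, ← forall_and]
  exact forall_congr' fun i => by constructor <;> rintro ⟨_, _⟩ <;> constructor <;> linarith

end Decomp

lemma isEigenDecomp_eigReal {A : Matrix (Fin n) (Fin n) ℝ} (hA : A.IsSymm) :
    IsEigenDecomp A (eigReal n A).2 (eigReal n A).1 := by
  have h : A.IsHermitian := by
    rwa [Matrix.IsHermitian, Matrix.conjTranspose_eq_transpose_of_trivial]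
  have hu := h.eigenvectorUnitary.2
  rw [Matrix.mem_unitaryGroup_iff, Matrix.star_eq_conjTranspose,
    Matrix.conjTranspose_eq_transpose_of_trivial] at hu
  rw [eigReal, dif_pos h]
  refine ⟨hu, mul_eq_one_comm.1 hu, ?_⟩
  have hs := h.spectral_theorem
  rw [Unitary.conjStarAlgAut_apply, Matrix.star_eq_conjTranspose,
    Matrix.conjTranspose_eq_transpose_of_trivial] at hs
  exact hs

lemma exists_isEigenDecomp {A : Matrix (Fin n) (Fin n) ℝ} (hA : A.IsSymm) :
    ∃ V a, IsEigenDecomp A V a :=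
  ⟨_, _, isEigenDecomp_eigReal hA⟩

lemma isSymm_of_mem_Q₁ {P : Data ℝ n} {X : Matrix (Fin n) (Fin n) ℝ} (hX : X ∈ Q₁ P) :
    X.IsSymm := by
  have h := hX.1.isHermitian
  rw [Matrix.IsHermitian, Matrix.conjTranspose_eq_transpose_of_trivial, Matrix.transpose_sub,
    Matrix.transpose_smul, Matrix.transpose_one] at h
  exact sub_left_injective h

lemma exists_isEigenDecomp_of_mem_Q₁ {P : Data ℝ n} {X : Matrix (Fin n) (Fin n) ℝ}
    (hX : X ∈ Q₁ P) : ∃ V a, IsEigenDecomp X V a ∧ ∀ i, P.α ≤ a i ∧ a i ≤ P.β := by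
  obtain ⟨V, a, h⟩ := exists_isEigenDecomp (isSymm_of_mem_Q₁ hX)
  exact ⟨V, a, h, (h.mem_Q₁_iff P).1 hX⟩

end Spectral

/-! ### Quadratic bounds for the logarithm -/

/-- A function on an interval is minimal at `a` if its derivative has the sign of `x - a`. -/
lemma le_of_sub_mul_deriv_nonneg {h h' : ℝ → ℝ} {l u a b : ℝ} (ha : a ∈ Set.Icc l u)
    (hb : b ∈ Set.Icc l u) (hd : ∀ x ∈ Set.Icc l u, HasDerivAt h (h' x) x)
    (hs : ∀ x ∈ Set.Icc l u, 0 ≤ (x - a) * h' x) : h a ≤ h b := by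
  rcases le_total a b with hab | hab
  · have hsub : Set.Icc a b ⊆ Set.Icc l u := Set.Icc_subset_Icc ha.1 hb.2
    refine monotoneOn_of_deriv_nonneg (convex_Icc a b)
      (fun x hx => (hd x (hsub hx)).continuousAt.continuousWithinAt)
      (fun x hx => (hd x (hsub (interior_subset hx))).differentiableAt.differentiableWithinAt)
      (fun x hx => ?_) ⟨le_rfl, hab⟩ ⟨hab, le_rfl⟩ hab
    rw [(hd x (hsub (interior_subset hx))).deriv]
    rw [interior_Icc] at hx
    exact nonneg_of_mul_nonneg_right (hs x (hsub ⟨hx.1.le, hx.2.le⟩)) (sub_pos.2 hx.1)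
  · have hsub : Set.Icc b a ⊆ Set.Icc l u := Set.Icc_subset_Icc hb.1 ha.2
    refine antitoneOn_of_deriv_nonpos (convex_Icc b a)
      (fun x hx => (hd x (hsub hx)).continuousAt.continuousWithinAt)
      (fun x hx => (hd x (hsub (interior_subset hx))).differentiableAt.differentiableWithinAt)
      (fun x hx => ?_) ⟨le_rfl, hab⟩ ⟨hab, le_rfl⟩ hab
    rw [(hd x (hsub (interior_subset hx))).deriv]
    rw [interior_Icc] at hx
    exact nonpos_of_mul_nonneg_right (hs x (hsub ⟨hx.1.le, hx.2.le⟩)) (sub_neg.2 hx.2)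

/-- The derivative of the Bregman distance of `-log` from `a`, up to a constant, minus a multiple of
the squared distance. -/
lemma hasDerivAt_log_bregman (a m : ℝ) {x : ℝ} (hx : 0 < x) :
    HasDerivAt (fun x => -Real.log x + a⁻¹ * (x - a) - m * (x - a) ^ 2)
      (-x⁻¹ + a⁻¹ - 2 * m * (x - a)) x := by
  have h1 := (Real.hasDerivAt_log hx.ne').neg
  have h2 := ((hasDerivAt_id x).sub_const a).const_mul a⁻¹
  have h3 := (((hasDerivAt_id x).sub_const a).pow 2).const_mul m
  refine ((h1.add h2).sub h3).congr_deriv ?_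
  simp only [id]
  ring

/-- On `(0, β]` the function `-log` is strongly convex with parameter `1 / β²`. -/
lemma neg_log_lower {β a b : ℝ} (ha : 0 < a) (haβ : a ≤ β) (hb : 0 < b) (hbβ : b ≤ β) :
    -Real.log a - a⁻¹ * (b - a) + (b - a) ^ 2 / (2 * β ^ 2) ≤ -Real.log b := by
  have hl : 0 < min a b := lt_min ha hb
  have h := le_of_sub_mul_deriv_nonneg (l := min a b) (u := β) (a := a) (b := b)
    ⟨min_le_left _ _, haβ⟩ ⟨min_le_right _ _, hbβ⟩
    (fun x hx => hasDerivAt_log_bregman a (1 / (2 * β ^ 2)) (hl.trans_le hx.1)) (fun x hx => ?_)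
  · simp only [sub_self] at h
    have : 1 / (2 * β ^ 2) * (b - a) ^ 2 = (b - a) ^ 2 / (2 * β ^ 2) := by ring
    linarith
  · have hx0 : 0 < x := hl.trans_le hx.1
    have hβ : 0 < β := ha.trans_le haβ
    have e : (x - a) * (-x⁻¹ + a⁻¹ - 2 * (1 / (2 * β ^ 2)) * (x - a)) =
        (x - a) ^ 2 * (1 / (a * x) - 1 / β ^ 2) := by
      field_simp; ring
    rw [e]
    refine mul_nonneg (sq_nonneg _) (sub_nonneg.2 (one_div_le_one_div_of_le (by positivity) ?_))
    rw [sq]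
    exact mul_le_mul haβ hx.2 hx0.le hβ.le

/-- On `[α, ∞)` the derivative of `-log` is Lipschitz with constant `1 / α²`. -/
lemma neg_log_upper {α a b : ℝ} (hα : 0 < α) (ha : α ≤ a) (hb : α ≤ b) :
    -Real.log b ≤ -Real.log a - a⁻¹ * (b - a) + (b - a) ^ 2 / (2 * α ^ 2) := by
  have h := le_of_sub_mul_deriv_nonneg (l := α) (u := max a b) (a := a) (b := b)
    ⟨ha, le_max_left _ _⟩ ⟨hb, le_max_right _ _⟩
    (fun x hx => (hasDerivAt_log_bregman a (1 / (2 * α ^ 2)) (hα.trans_le hx.1)).neg)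
    (fun x hx => ?_)
  · simp only [Pi.neg_apply, sub_self] at h
    have : 1 / (2 * α ^ 2) * (b - a) ^ 2 = (b - a) ^ 2 / (2 * α ^ 2) := by ring
    linarith
  · have hx0 : 0 < x := hα.trans_le hx.1
    have ha0 : 0 < a := hα.trans_le ha
    have e : (x - a) * -(-x⁻¹ + a⁻¹ - 2 * (1 / (2 * α ^ 2)) * (x - a)) =
        (x - a) ^ 2 * (1 / α ^ 2 - 1 / (a * x)) := by
      field_simp; ring
    rw [e]
    refine mul_nonneg (sq_nonneg _) (sub_nonneg.2 (one_div_le_one_div_of_le (by positivity) ?_))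
    rw [sq]
    exact mul_le_mul ha hx.1 hα.le ha0.le

section Bounds

variable {n : ℕ} {P : Data ℝ n}

/-! ### Convexity and smoothness of the log-determinant on `Q₁` -/

/-- The Bregman distance of `-log det` is the average over the overlap of the eigenbases of the
Bregman distances of `-log` between the eigenvalues. -/
lemma log_det_bregman {A B V W : Matrix (Fin n) (Fin n) ℝ} {a b : Fin n → ℝ}
    (hV : IsEigenDecomp A V a) (hW : IsEigenDecomp B W b) (ha : ∀ i, 0 < a i)
    (hb : ∀ i, 0 < b i) :
    -Real.log B.det + Real.log A.det + frob A⁻¹ (B - A) = ∑ i, ∑ j, overlap V W i j *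
      (-Real.log (b j) + Real.log (a i) + (a i)⁻¹ * (b j - a i)) := by
  have hI := hV.inv fun i => (ha i).ne'
  rw [map_sub, frob_spectral_same hI hV, frob_spectral hI hW, hV.log_det ha, hW.log_det hb,
    hV.sum_left hW (fun i => (a i)⁻¹ * a i),
    hV.sum_left hW (fun i => Real.log (a i)), hV.sum_right hW (fun j => Real.log (b j))]
  simp only [← Finset.sum_neg_distrib, ← Finset.sum_add_distrib, ← Finset.sum_sub_distrib]
  exact Finset.sum_congr rfl fun i _ => Finset.sum_congr rfl fun j _ => by ring

/-- Strong convexity of `-log det` on `Q₁`, in first-order form. -/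
lemma neg_log_det_lower (hα : 0 < P.α) {A B : Matrix (Fin n) (Fin n) ℝ} (hA : A ∈ Q₁ P)
    (hB : B ∈ Q₁ P) :
    frobSq (B - A) / (2 * P.β ^ 2) ≤ -Real.log B.det + Real.log A.det + frob A⁻¹ (B - A) := by
  obtain ⟨V, a, hV, ha⟩ := exists_isEigenDecomp_of_mem_Q₁ hA
  obtain ⟨W, b, hW, hb⟩ := exists_isEigenDecomp_of_mem_Q₁ hB
  have ha0 : ∀ i, 0 < a i := fun i => hα.trans_le (ha i).1
  have hb0 : ∀ i, 0 < b i := fun i => hα.trans_le (hb i).1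
  rw [frobSq_sub_comm, frobSq_sub_spectral hV hW, log_det_bregman hV hW ha0 hb0]
  simp only [Finset.sum_div]
  refine Finset.sum_le_sum fun i _ => Finset.sum_le_sum fun j _ => ?_
  rw [mul_div_assoc]
  refine mul_le_mul_of_nonneg_left ?_ (overlap_nonneg V W i j)
  have := neg_log_lower (ha0 i) (ha i).2 (hb0 j) (hb j).2
  rw [← neg_sq, neg_sub]
  linarith

/-- The quadratic upper bound for `-log det` on `Q₁` that corresponds to the Lipschitz continuity of
its gradient. -/
lemma neg_log_det_upper (hα : 0 < P.α) {A B : Matrix (Fin n) (Fin n) ℝ} (hA : A ∈ Q₁ P)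
    (hB : B ∈ Q₁ P) :
    -Real.log B.det + Real.log A.det + frob A⁻¹ (B - A) ≤ frobSq (B - A) / (2 * P.α ^ 2) := by
  obtain ⟨V, a, hV, ha⟩ := exists_isEigenDecomp_of_mem_Q₁ hA
  obtain ⟨W, b, hW, hb⟩ := exists_isEigenDecomp_of_mem_Q₁ hB
  have ha0 : ∀ i, 0 < a i := fun i => hα.trans_le (ha i).1
  have hb0 : ∀ i, 0 < b i := fun i => hα.trans_le (hb i).1
  rw [frobSq_sub_comm, frobSq_sub_spectral hV hW, log_det_bregman hV hW ha0 hb0]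
  simp only [Finset.sum_div]
  refine Finset.sum_le_sum fun i _ => Finset.sum_le_sum fun j _ => ?_
  rw [mul_div_assoc]
  refine mul_le_mul_of_nonneg_left ?_ (overlap_nonneg V W i j)
  have := neg_log_upper hα (ha i).1 (hb j).1
  rw [← neg_sq, neg_sub]
  linarith

lemma frobSq_inv_sub_inv_le (hα : 0 < P.α) {A B : Matrix (Fin n) (Fin n) ℝ} (hA : A ∈ Q₁ P)
    (hB : B ∈ Q₁ P) : frobSq (A⁻¹ - B⁻¹) ≤ lipM P ^ 2 * frobSq (A - B) := by
  obtain ⟨V, a, hV, ha⟩ := exists_isEigenDecomp_of_mem_Q₁ hA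
  obtain ⟨W, b, hW, hb⟩ := exists_isEigenDecomp_of_mem_Q₁ hB
  have ha0 : ∀ i, 0 < a i := fun i => hα.trans_le (ha i).1
  have hb0 : ∀ i, 0 < b i := fun i => hα.trans_le (hb i).1
  rw [frobSq_sub_spectral (hV.inv fun i => (ha0 i).ne') (hW.inv fun i => (hb0 i).ne'),
    frobSq_sub_spectral hV hW]
  simp only [Finset.mul_sum]
  refine Finset.sum_le_sum fun i _ => Finset.sum_le_sum fun j _ => ?_
  rw [mul_left_comm]
  refine mul_le_mul_of_nonneg_left ?_ (overlap_nonneg V W i j)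
  have h1 : (a i)⁻¹ - (b j)⁻¹ = (b j - a i) * (1 / (a i * b j)) := by
    have := ha0 i; have := hb0 j
    field_simp
  rw [h1, mul_pow, lipM, mul_comm, ← neg_sq (b j - a i), neg_sub]
  have h2 : 1 / (a i * b j) ≤ 1 / P.α ^ 2 := by
    refine one_div_le_one_div_of_le (by positivity) ?_
    rw [sq]
    exact mul_le_mul (ha i).1 (hb j).1 hα.le (ha0 i).le
  have h3 : 0 ≤ 1 / (a i * b j) := by have := ha0 i; have := hb0 j; positivity
  gcongr

lemma convexComb_mem_Q₁ {A B : Matrix (Fin n) (Fin n) ℝ} (hA : A ∈ Q₁ P) (hB : B ∈ Q₁ P) {s t : ℝ}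
    (hs : 0 ≤ s) (ht : 0 ≤ t) (hst : s + t = 1) : s • A + t • B ∈ Q₁ P := by
  constructor
  · have h := (hA.1.smul hs).add (hB.1.smul ht)
    convert h using 1
    rw [smul_sub, smul_sub, ← add_sub_add_comm, ← add_smul, hst, one_smul]
  · have h := (hA.2.smul hs).add (hB.2.smul ht)
    convert h using 1
    rw [smul_sub, smul_sub, ← add_sub_add_comm, ← add_smul, hst, one_smul]

/-- Strong convexity of the prox-function, from its first-order form at the intermediate point. -/
lemma prox₁_strongConvex (hα : 0 < P.α) {X X' : Matrix (Fin n) (Fin n) ℝ} (hX : X ∈ Q₁ P)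
    (hX' : X' ∈ Q₁ P) {t : ℝ} (ht : t ∈ Set.Icc (0 : ℝ) 1) :
    prox₁ P (t • X + (1 - t) • X') ≤ t * prox₁ P X + (1 - t) * prox₁ P X' -
      σ₁ P / 2 * t * (1 - t) * frobSq (X - X') := by
  have ht' : 0 ≤ 1 - t := sub_nonneg.2 ht.2
  have hA := convexComb_mem_Q₁ hX hX' ht.1 ht' (by ring)
  set A := t • X + (1 - t) • X' with hAdef
  have h1 := mul_le_mul_of_nonneg_left (neg_log_det_lower hα hA hX) ht.1
  have h2 := mul_le_mul_of_nonneg_left (neg_log_det_lower hα hA hX') ht'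
  have e1 : X - A = (1 - t) • (X - X') := by rw [hAdef]; module
  have e2 : X' - A = (-t) • (X - X') := by rw [hAdef]; module
  rw [e1, frob_smul_right, frobSq_smul] at h1
  rw [e2, frob_smul_right, frobSq_smul] at h2
  simp only [prox₁, σ₁]
  have e3 : 1 / P.β ^ 2 / 2 * t * (1 - t) * frobSq (X - X') =
      t * ((1 - t) ^ 2 * frobSq (X - X') / (2 * P.β ^ 2)) +
        (1 - t) * ((-t) ^ 2 * frobSq (X - X') / (2 * P.β ^ 2)) := by ring
  rw [e3]
  linarith

/-! ### Extremal values of the prox-functions -/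

lemma isEigenDecomp_smul_one (t : ℝ) :
    IsEigenDecomp (t • (1 : Matrix (Fin n) (Fin n) ℝ)) 1 (fun _ => t) := by
  refine ⟨by simp, by simp, ?_⟩
  rw [Matrix.one_mul, Matrix.transpose_one, Matrix.mul_one, Matrix.smul_one_eq_diagonal]

lemma smul_one_mem_Q₁ {t : ℝ} (h1 : P.α ≤ t) (h2 : t ≤ P.β) :
    t • (1 : Matrix (Fin n) (Fin n) ℝ) ∈ Q₁ P :=
  ((isEigenDecomp_smul_one t).mem_Q₁_iff P).2 fun _ => ⟨h1, h2⟩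

lemma prox₁_smul_one {t : ℝ} (ht : 0 < t) :
    prox₁ P (t • (1 : Matrix (Fin n) (Fin n) ℝ)) = n * (Real.log P.β - Real.log t) := by
  rw [prox₁, (isEigenDecomp_smul_one t).log_det fun _ => ht]
  simp
  ring

lemma prox₁_isGreatest (hα : 0 < P.α) (hαβ : P.α ≤ P.β) :
    IsGreatest (prox₁ P '' Q₁ P) (n * Real.log (P.β / P.α)) := by
  rw [Real.log_div (hα.trans_le hαβ).ne' hα.ne']
  refine ⟨⟨_, smul_one_mem_Q₁ le_rfl hαβ, prox₁_smul_one hα⟩, ?_⟩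
  rintro _ ⟨X, hX, rfl⟩
  obtain ⟨V, a, hV, ha⟩ := exists_isEigenDecomp_of_mem_Q₁ hX
  rw [prox₁, hV.log_det fun i => hα.trans_le (ha i).1]
  have : ∑ _i : Fin n, Real.log P.α ≤ ∑ i, Real.log (a i) :=
    Finset.sum_le_sum fun i _ => Real.log_le_log hα (ha i).1
  simp at this
  linarith

lemma D₁_eq (hα : 0 < P.α) (hαβ : P.α ≤ P.β) : D₁ P = n * Real.log (P.β / P.α) :=
  (prox₁_isGreatest hα hαβ).csSup_eq

lemma prox₂_isGreatest (n : ℕ) : IsGreatest (prox₂ '' Q₂ n) ((n : ℝ) ^ 2 / 2) := by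
  refine ⟨⟨Matrix.of fun _ _ => 1, ⟨by ext; simp, by simp⟩, ?_⟩, ?_⟩
  · simp [prox₂, frobSq_apply, sq]
  · rintro _ ⟨U, hU, rfl⟩
    rw [prox₂, frobSq_apply]
    have : ∑ i, ∑ j, U i j ^ 2 ≤ ∑ _i : Fin n, ∑ _j : Fin n, (1 : ℝ) :=
      Finset.sum_le_sum fun i _ => Finset.sum_le_sum fun j _ =>
        (sq_le_one_iff_abs_le_one _).2 (hU.2 i j)
    simp only [Finset.sum_const, Finset.card_univ, Fintype.card_fin, nsmul_eq_mul, mul_one] at this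
    rw [sq]
    linarith

lemma D₂_eq (n : ℕ) : D₂ n = (n : ℝ) ^ 2 / 2 := (prox₂_isGreatest n).csSup_eq

/-! ### Explicit minimizers over `Q₁` -/

lemma clipEig_mem (hαβ : P.α ≤ P.β) (t : ℝ) : P.α ≤ clipEig P t ∧ clipEig P t ≤ P.β :=
  ⟨le_min (le_max_right _ _) hαβ, min_le_right _ _⟩

lemma clipInv_mem (hαβ : P.α ≤ P.β) (t : ℝ) : P.α ≤ clipInv P t ∧ clipInv P t ≤ P.β := by
  unfold clipInv
  split_ifs
  · exact ⟨hαβ, le_rfl⟩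
  · exact ⟨le_min (le_max_right _ _) hαβ, min_le_right _ _⟩

/-- The variational inequality of the scalar projection on `[α, β]`. -/
lemma clipEig_optimal (hαβ : P.α ≤ P.β) (d : ℝ) {y : ℝ} (hy : P.α ≤ y ∧ y ≤ P.β) :
    (clipEig P d - d) ^ 2 + (y - clipEig P d) ^ 2 ≤ (y - d) ^ 2 := by
  suffices h : 0 ≤ (clipEig P d - d) * (y - clipEig P d) by nlinarith
  unfold clipEig
  rcases le_total d P.α with h | h
  · rw [max_eq_right h, min_eq_left hαβ]
    exact mul_nonneg (by linarith) (by linarith)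
  · rw [max_eq_left h]
    rcases le_total d P.β with h' | h'
    · simp [min_eq_left h']
    · rw [min_eq_right h']
      exact mul_nonneg_of_nonpos_of_nonpos (by linarith) (by linarith)

/-- `clipInv P s` minimizes `-log z + s z` over `[α, β]`, with the quadratic growth that strong
convexity gives. -/
lemma clipInv_optimal (hα : 0 < P.α) (hαβ : P.α ≤ P.β) (s : ℝ) {z : ℝ}
    (hz : P.α ≤ z ∧ z ≤ P.β) :
    -Real.log (clipInv P s) + s * clipInv P s + (z - clipInv P s) ^ 2 / (2 * P.β ^ 2) ≤
      -Real.log z + s * z := by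
  have hc := clipInv_mem hαβ s
  have hc0 := hα.trans_le hc.1
  have hlog := neg_log_lower hc0 hc.2 (hα.trans_le hz.1) hz.2
  suffices h : 0 ≤ (s - (clipInv P s)⁻¹) * (z - clipInv P s) by
    rw [sub_mul, mul_sub] at h
    linarith
  have hβ : 0 < P.β := hα.trans_le hαβ
  unfold clipInv
  split_ifs with hs
  · have : 0 < P.β⁻¹ := inv_pos.2 hβ
    exact mul_nonneg_of_nonpos_of_nonpos (by linarith) (by linarith)
  · push Not at hs
    rcases le_total (1 / s) P.α with h | h
    · rw [max_eq_right h, min_eq_left hαβ]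
      have : P.α⁻¹ ≤ s := by
        rw [one_div] at h
        exact inv_le_of_inv_le₀ hs h
      exact mul_nonneg (by linarith) (by linarith)
    · rw [max_eq_left h]
      rcases le_total (1 / s) P.β with h' | h'
      · rw [min_eq_left h', one_div, inv_inv, sub_self, zero_mul]
      · rw [min_eq_right h']
        have : s ≤ P.β⁻¹ := by
          rw [one_div] at h'
          exact le_inv_of_le_inv₀ hβ h'
        exact mul_nonneg_of_nonpos_of_nonpos (by linarith) (by linarith)

/-- Clipping the eigenvalues is the projection on `Q₁`: compare with a competitor in the average
over the overlap of the eigenbases. -/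
lemma isUniqueMinOn_proj (hαβ : P.α ≤ P.β) {B V : Matrix (Fin n) (Fin n) ℝ} {d : Fin n → ℝ}
    (hB : IsEigenDecomp B V d) :
    IsUniqueMinOn (fun Y => frobSq (Y - B)) (Q₁ P)
      (V * Matrix.diagonal (fun i => clipEig P (d i)) * V.transpose) := by
  have hC := hB.map (clipEig P)
  refine ⟨(hC.mem_Q₁_iff P).2 fun i => clipEig_mem hαβ _, fun Y hY hne => ?_⟩
  have hpos := frobSq_pos_of_ne hne
  set C := V * Matrix.diagonal (fun i => clipEig P (d i)) * V.transpose
  obtain ⟨W, y, hW, hy⟩ := exists_isEigenDecomp_of_mem_Q₁ hY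
  suffices h : frobSq (C - B) + frobSq (Y - C) ≤ frobSq (Y - B) by
    change frobSq (C - B) < frobSq (Y - B)
    linarith
  have h0 : frobSq (C - B) = ∑ i, (clipEig P (d i) - d i) ^ 2 := by
    rw [frobSq_sub, hC.frobSq_eq, hB.frobSq_eq, frob_spectral_same hC hB, Finset.mul_sum,
      ← Finset.sum_sub_distrib, ← Finset.sum_add_distrib]
    exact Finset.sum_congr rfl fun i _ => by ring
  rw [frobSq_sub_comm Y C, frobSq_sub_comm Y B, frobSq_sub_spectral hC hW,
    frobSq_sub_spectral hB hW, h0, hC.sum_left hW]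
  simp only [← Finset.sum_add_distrib]
  refine Finset.sum_le_sum fun i _ => Finset.sum_le_sum fun j _ => ?_
  rw [← mul_add]
  refine mul_le_mul_of_nonneg_left ?_ (overlap_nonneg V W i j)
  have := clipEig_optimal hαβ (d i) (hy j)
  nlinarith

/-- The spectral formula for the minimizer of `-log det Z + ⟨B, Z⟩`, with the quadratic growth
that strong convexity gives. -/
lemma prox_growth (hα : 0 < P.α) (hαβ : P.α ≤ P.β) {B V Z : Matrix (Fin n) (Fin n) ℝ}
    {d : Fin n → ℝ} (hB : IsEigenDecomp B V d) (hZ : Z ∈ Q₁ P) :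
    prox₁ P (V * Matrix.diagonal (fun i => clipInv P (d i)) * V.transpose) +
        frob B (V * Matrix.diagonal (fun i => clipInv P (d i)) * V.transpose) +
        σ₁ P / 2 * frobSq (Z - V * Matrix.diagonal (fun i => clipInv P (d i)) * V.transpose) ≤
      prox₁ P Z + frob B Z := by
  have hC := hB.map (clipInv P)
  set C := V * Matrix.diagonal (fun i => clipInv P (d i)) * V.transpose
  obtain ⟨W, z, hW, hz⟩ := exists_isEigenDecomp_of_mem_Q₁ hZ
  rw [prox₁, prox₁, hC.log_det fun i => hα.trans_le (clipInv_mem hαβ _).1,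
    hW.log_det fun i => hα.trans_le (hz i).1, frobSq_sub_comm, frobSq_sub_spectral hC hW,
    frob_spectral_same hB hC, frob_spectral hB hW, hC.sum_left hW (fun i => Real.log _),
    hC.sum_left hW (fun i => d i * _), hC.sum_right hW (fun j => Real.log (z j)),
    add_right_comm (-∑ i, _), add_right_comm _ ((n : ℝ) * _),
    add_right_comm _ ((n : ℝ) * _), add_le_add_iff_right]
  simp only [← Finset.sum_add_distrib, ← Finset.sum_neg_distrib, Finset.mul_sum]
  refine Finset.sum_le_sum fun i _ => Finset.sum_le_sum fun j _ => ?_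
  have h := mul_le_mul_of_nonneg_left (clipInv_optimal hα hαβ (d i) (hz j))
    (overlap_nonneg V W i j)
  refine le_trans (le_of_eq ?_) (h.trans (le_of_eq ?_))
  · rw [σ₁]; ring
  · ring

lemma σ₁_pos (hα : 0 < P.α) (hαβ : P.α ≤ P.β) : 0 < σ₁ P := by
  have := hα.trans_le hαβ
  rw [σ₁]; positivity

lemma isUniqueMinOn_prox (hα : 0 < P.α) (hαβ : P.α ≤ P.β) {B V : Matrix (Fin n) (Fin n) ℝ}
    {d : Fin n → ℝ} (hB : IsEigenDecomp B V d) :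
    IsUniqueMinOn (fun Z => prox₁ P Z + frob B Z) (Q₁ P)
      (V * Matrix.diagonal (fun i => clipInv P (d i)) * V.transpose) := by
  refine ⟨((hB.map (clipInv P)).mem_Q₁_iff P).2 fun i => clipInv_mem hαβ _, fun Z hZ hne => ?_⟩
  have h := prox_growth hα hαβ hB hZ
  have h2 := mul_pos (half_pos (σ₁_pos hα hαβ)) (frobSq_pos_of_ne hne)
  exact lt_of_lt_of_le (lt_add_of_pos_right _ h2) h

end Bounds

section Smoothing

variable {n : ℕ} {P : Data ℝ n}

/-! ### Gradients on the space of symmetric matrices -/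

section Grad

open scoped Matrix.Norms.Frobenius

lemma frobenius_norm_sq (X : Matrix (Fin n) (Fin n) ℝ) : ‖X‖ ^ 2 = frobSq X := by
  rw [Matrix.frobenius_norm_def, ← Real.sqrt_eq_rpow, Real.sq_sqrt (by positivity), frobSq_apply]
  simp

/-- A quadratic error bound near `X` on the symmetric matrices identifies the gradient. -/
lemma hasGradOnSymm_of_quadratic_error {f : Matrix (Fin n) (Fin n) ℝ → ℝ}
    {G X : Matrix (Fin n) (Fin n) ℝ} (hG : G.IsSymm) {r K : ℝ} (hr : 0 < r)
    (h : ∀ Y : Matrix (Fin n) (Fin n) ℝ, Y.IsSymm → frobSq (Y - X) < r ^ 2 →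
      |f Y - f X - frob G (Y - X)| ≤ K * frobSq (Y - X)) : HasGradOnSymm f G X := by
  refine ⟨hG, ?_⟩
  have hO : (fun Y => f Y - f X - frob G (Y - X)) =O[nhdsWithin X {Y | Y.IsSymm}]
      fun Y => ‖Y - X‖ ^ 2 := by
    refine Asymptotics.IsBigO.of_bound K ?_
    filter_upwards [self_mem_nhdsWithin, mem_nhdsWithin_of_mem_nhds (Metric.ball_mem_nhds X hr)]
      with Y hY hYr
    rw [Metric.mem_ball, dist_eq_norm] at hYr
    rw [Real.norm_eq_abs, Real.norm_of_nonneg (sq_nonneg _), frobenius_norm_sq]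
    exact h Y hY (by rw [← frobenius_norm_sq]; gcongr)
  have ho : (fun Y => f Y - f X - frob G (Y - X)) =o[nhdsWithin X {Y | Y.IsSymm}]
      fun Y => Y - X := by
    refine hO.trans_isLittleO ?_
    have h1 : (fun Y : Matrix (Fin n) (Fin n) ℝ => ‖Y - X‖ ^ 2) =o[nhds X] fun Y => Y - X :=
      Asymptotics.isLittleO_pow_sub_sub X one_lt_two
    exact h1.mono nhdsWithin_le_nhds
  exact HasFDerivWithinAt.of_isLittleO ho

lemma hasGradOnSymm_unique {f : Matrix (Fin n) (Fin n) ℝ → ℝ}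
    {G G' X : Matrix (Fin n) (Fin n) ℝ} (hX : X.IsSymm) (h : HasGradOnSymm f G X)
    (h' : HasGradOnSymm f G' X) : G = G' := by
  have hs : ∀ t : ℝ, (X + t • (G - G')).IsSymm := fun t =>
    hX.add ((h.1.sub h'.1).smul t)
  have hd : HasDerivWithinAt (fun t : ℝ => X + t • (G - G')) (G - G') Set.univ 0 := by
    have h1 := ((hasDerivAt_id (0 : ℝ)).smul_const (G - G')).const_add X
    rw [one_smul] at h1
    exact h1.hasDerivWithinAt
  have e0 : X + (0 : ℝ) • (G - G') = X := by simp
  have key : ∀ A, HasGradOnSymm f A X →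
      HasDerivAt (fun t : ℝ => f (X + t • (G - G'))) (frob A (G - G')) 0 := by
    intro A hA
    rw [← hasDerivWithinAt_univ]
    have hA2 := hA.2
    exact HasFDerivWithinAt.comp_hasDerivWithinAt (t := {Y | Y.IsSymm}) (0 : ℝ)
      (by rw [e0]; exact hA2) hd (fun t _ => hs t)
  have := (key G h).unique (key G' h')
  by_contra hne
  have hpos := frobSq_pos_of_ne hne
  rw [frobSq, frob_sub_left] at hpos
  linarith

end Grad

/-- The eigenvalues of a symmetric matrix at Frobenius distance less than `r` from `X ∈ Q₁` lie in
the `r`-neighbourhood of `[α, β]`. -/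
lemma mem_Q₁_of_frobSq_lt {X Y : Matrix (Fin n) (Fin n) ℝ} (hX : X ∈ Q₁ P) (hY : Y.IsSymm) {r : ℝ}
    (hr : 0 ≤ r) (h : frobSq (Y - X) < r ^ 2) :
    Y ∈ Q₁ { P with α := P.α - r, β := P.β + r } := by
  obtain ⟨V, a, hV, ha⟩ := exists_isEigenDecomp_of_mem_Q₁ hX
  obtain ⟨W, y, hW⟩ := exists_isEigenDecomp hY
  refine (hW.mem_Q₁_iff _).2 fun j => ?_
  rw [frobSq_sub_comm, frobSq_sub_spectral hV hW, Finset.sum_comm] at h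
  -- for every `j`, an average over the eigenvalues of `X` is less than `r ^ 2`, so one term is
  have hj : ∑ i, overlap V W i j * (a i - y j) ^ 2 < ∑ i, overlap V W i j * r ^ 2 := by
    rw [← Finset.sum_mul, sum_overlap_left hV.1 hW.2.1, one_mul]
    refine lt_of_le_of_lt (Finset.single_le_sum
      (f := fun j => ∑ i, overlap V W i j * (a i - y j) ^ 2) (fun j _ => ?_)
      (Finset.mem_univ j)) h
    exact Finset.sum_nonneg fun i _ => mul_nonneg (overlap_nonneg _ _ _ _) (sq_nonneg _)
  obtain ⟨i, -, hi⟩ := Finset.exists_lt_of_sum_lt hj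
  have hi2 := abs_lt_of_sq_lt_sq (lt_of_mul_lt_mul_left hi (overlap_nonneg V W i j)) hr
  rw [abs_lt] at hi2
  have := ha i
  constructor <;> simp only <;> linarith

lemma Q₁_subset_enlarge {r : ℝ} (hr : 0 ≤ r) :
    Q₁ P ⊆ Q₁ { P with α := P.α - r, β := P.β + r } := by
  intro X hX
  obtain ⟨V, a, hV, ha⟩ := exists_isEigenDecomp_of_mem_Q₁ hX
  refine (hV.mem_Q₁_iff _).2 fun i => ?_
  have := ha i
  constructor <;> simp only <;> linarith

lemma inv_isSymm {X : Matrix (Fin n) (Fin n) ℝ} (hX : X.IsSymm) : X⁻¹.IsSymm := by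
  rw [Matrix.IsSymm, Matrix.transpose_nonsing_inv, hX]

lemma Data.Valid.symm (hP : P.Valid) : P.S.IsSymm := by
  have h := hP.posSemidef.isHermitian
  rwa [Matrix.IsHermitian, Matrix.conjTranspose_eq_transpose_of_trivial] at h

/-- On the neighbourhood of `X` of radius `α / 2` the eigenvalues stay above `α / 2`, and there the
quadratic bounds for `-log det` hold. -/
lemma smoothPart_quadratic_error (hα : 0 < P.α) {X Y : Matrix (Fin n) (Fin n) ℝ} (hX : X ∈ Q₁ P)
    (hY : Y.IsSymm) (hYX : frobSq (Y - X) < (P.α / 2) ^ 2) :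
    |smoothPart P Y - smoothPart P X - frob (-X⁻¹ + P.S) (Y - X)| ≤
      1 / (2 * (P.α / 2) ^ 2) * frobSq (Y - X) := by
  have hr : 0 < P.α / 2 := half_pos hα
  have hY' := mem_Q₁_of_frobSq_lt hX hY hr.le hYX
  have hX' := Q₁_subset_enlarge hr.le hX
  have h1 := neg_log_det_lower (by simp only; linarith) hX' hY'
  have h2 := neg_log_det_upper (by simp only; linarith) hX' hY'
  simp only [sub_half] at h2
  have h3 : smoothPart P Y - smoothPart P X - frob (-X⁻¹ + P.S) (Y - X) =
      -Real.log Y.det + Real.log X.det + frob X⁻¹ (Y - X) := by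
    rw [smoothPart, smoothPart, frob_add_left, frob_neg_left, map_sub (frob P.S)]
    ring
  rw [h3, abs_of_nonneg (le_trans (by have := frobSq_nonneg (Y - X); positivity) h1)]
  exact h2.trans (le_of_eq (by ring))

lemma hasGradOnSymm_smoothPart (hP : P.Valid) {X : Matrix (Fin n) (Fin n) ℝ} (hX : X ∈ Q₁ P) :
    HasGradOnSymm (smoothPart P) (-X⁻¹ + P.S) X :=
  hasGradOnSymm_of_quadratic_error ((inv_isSymm (isSymm_of_mem_Q₁ hX)).neg.add hP.symm)
    (half_pos hP.α_pos) fun _ hY hYX => smoothPart_quadratic_error hP.α_pos hX hY hYX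

lemma smoothPart_lower (hα : 0 < P.α) {X Y : Matrix (Fin n) (Fin n) ℝ} (hX : X ∈ Q₁ P)
    (hY : Y ∈ Q₁ P) : smoothPart P X + frob (-X⁻¹ + P.S) (Y - X) ≤ smoothPart P Y := by
  have h1 := neg_log_det_lower hα hX hY
  have h2 : 0 ≤ frobSq (Y - X) / (2 * P.β ^ 2) := by have := frobSq_nonneg (Y - X); positivity
  rw [smoothPart, smoothPart, frob_add_left, frob_neg_left, map_sub (frob P.S)]
  linarith

lemma smoothPart_upper (hα : 0 < P.α) {X Y : Matrix (Fin n) (Fin n) ℝ} (hX : X ∈ Q₁ P)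
    (hY : Y ∈ Q₁ P) : smoothPart P Y ≤
      smoothPart P X + frob (-X⁻¹ + P.S) (Y - X) + lipM P / 2 * frobSq (Y - X) := by
  have h1 := neg_log_det_upper hα hX hY
  have h2 : frobSq (Y - X) / (2 * P.α ^ 2) = lipM P / 2 * frobSq (Y - X) := by rw [lipM]; ring
  rw [smoothPart, smoothPart, frob_add_left, frob_neg_left, map_sub (frob P.S)]
  linarith

/-! ### The smoothed penalty -/

lemma D₂_pos (hP : P.Valid) : 0 < D₂ n := by
  have : (0 : ℝ) < n := by exact_mod_cast hP.dim_pos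
  rw [D₂_eq]; positivity

lemma mu_pos (hP : P.Valid) : 0 < mu P := by
  have := D₂_pos hP; have := hP.ε_pos
  rw [mu]; positivity

lemma mu_mul_D₂ (hP : P.Valid) : mu P * D₂ n = P.ε / 2 := by
  have := D₂_pos hP
  rw [mu]; field_simp

/-- The variational inequality of the scalar projection on `[-1, 1]`. -/
lemma clip_optimal (t : ℝ) {v : ℝ} (hv : |v| ≤ 1) :
    0 ≤ (t - max (min t 1) (-1)) * (max (min t 1) (-1) - v) := by
  rw [abs_le] at hv
  rcases le_total t 1 with h | h
  · rw [min_eq_left h]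
    rcases le_total t (-1) with h' | h'
    · rw [max_eq_right h']
      exact mul_nonneg_of_nonpos_of_nonpos (by linarith) (by linarith)
    · simp [max_eq_left h']
  · rw [min_eq_right h, max_eq_left (by norm_num)]
    exact mul_nonneg (by linarith) (by linarith)

lemma clipU_mem {X : Matrix (Fin n) (Fin n) ℝ} (hX : X.IsSymm) : clipU P X ∈ Q₂ n := by
  refine ⟨?_, fun i j => ?_⟩
  · ext i j
    simp [clipU, hX.apply i j]
  · rw [clipU, Matrix.of_apply, abs_le]
    exact ⟨le_max_right _ _, max_le (min_le_right _ _) (by norm_num)⟩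

/-- The quadratic growth of the inner maximization problem at its solution `U*(X)`. -/
lemma clipU_optimal (hP : P.Valid) (X : Matrix (Fin n) (Fin n) ℝ) {V : Matrix (Fin n) (Fin n) ℝ}
    (hV : V ∈ Q₂ n) :
    P.ρ * frob X V - mu P * prox₂ V + mu P / 2 * frobSq (V - clipU P X) ≤
      P.ρ * frob X (clipU P X) - mu P * prox₂ (clipU P X) := by
  have hμ := mu_pos hP
  have e : P.ρ * frob X (clipU P X) - mu P * prox₂ (clipU P X) - (P.ρ * frob X V - mu P * prox₂ V +
      mu P / 2 * frobSq (V - clipU P X)) =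
      frob (P.ρ • X - mu P • clipU P X) (clipU P X - V) := by
    rw [frobSq_sub, prox₂, prox₂, frob_sub_left, frob_smul_left, frob_smul_left, map_sub, map_sub,
      frob_comm V, ← frobSq]
    ring
  rw [← sub_nonneg, e, frob_apply]
  refine Finset.sum_nonneg fun i _ => Finset.sum_nonneg fun j _ => ?_
  have h := mul_nonneg hμ.le (clip_optimal (P.ρ * X i j / mu P) (hV.2 i j))
  simp only [Matrix.sub_apply, Matrix.smul_apply, smul_eq_mul, clipU, Matrix.of_apply]
  rw [← mul_assoc, mul_sub (mu P), mul_div_cancel₀ _ hμ.ne'] at h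
  exact h

lemma isUniqueMinOn_clipU (hP : P.Valid) {X : Matrix (Fin n) (Fin n) ℝ} (hX : X.IsSymm) :
    IsUniqueMinOn (fun U => -(P.ρ * frob X U - mu P * prox₂ U)) (Q₂ n) (clipU P X) := by
  refine ⟨clipU_mem hX, fun V hV hne => neg_lt_neg ?_⟩
  have h1 := clipU_optimal hP X hV
  have h2 := mul_pos (half_pos (mu_pos hP)) (frobSq_pos_of_ne hne)
  linarith

/-- The value `max_{U ∈ Q₂} ⟨ρ X, U⟩ - μ d₂(U)`, written with its maximizer. -/
noncomputable def smoothedPenalty (P : Data ℝ n) (X : Matrix (Fin n) (Fin n) ℝ) : ℝ :=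
  P.ρ * frob X (clipU P X) - mu P * prox₂ (clipU P X)

lemma le_smoothedPenalty (hP : P.Valid) (X : Matrix (Fin n) (Fin n) ℝ)
    {V : Matrix (Fin n) (Fin n) ℝ} (hV : V ∈ Q₂ n) :
    P.ρ * frob X V - mu P * prox₂ V ≤ smoothedPenalty P X := by
  have h1 := clipU_optimal hP X hV
  have h2 := mul_nonneg (half_pos (mu_pos hP)).le (frobSq_nonneg (V - clipU P X))
  rw [smoothedPenalty]
  linarith

lemma smoothed_eq (hP : P.Valid) {X : Matrix (Fin n) (Fin n) ℝ} (hX : X.IsSymm) :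
    smoothed P X = smoothPart P X + smoothedPenalty P X := by
  rw [smoothed]
  congr 1
  refine IsGreatest.csSup_eq ⟨⟨_, clipU_mem hX, rfl⟩, ?_⟩
  rintro _ ⟨V, hV, rfl⟩
  exact le_smoothedPenalty hP X hV

lemma huber_eq (hP : P.Valid) (x : ℝ) :
    huber P x = P.ρ * (x * max (min (P.ρ * x / mu P) 1) (-1)) -
      mu P * (max (min (P.ρ * x / mu P) 1) (-1) ^ 2 / 2) := by
  have hμ := mu_pos hP
  have hρ := hP.ρ_pos
  have hD := D₂_pos hP
  have e1 : P.ε / (2 * P.ρ * D₂ n) = mu P / P.ρ := by rw [mu]; field_simp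
  have e2 : P.ε / (4 * D₂ n) = mu P / 2 := by rw [mu]; field_simp; norm_num
  have e3 : D₂ n * P.ρ ^ 2 * x ^ 2 / P.ε = P.ρ ^ 2 * x ^ 2 / (2 * mu P) := by
    have := hP.ε_pos
    rw [mu]; field_simp
  rw [huber, e1, e2, e3]
  split_ifs with h
  · rw [div_le_iff₀ hρ] at h
    rcases le_total 0 x with hx | hx
    · rw [abs_of_nonneg hx] at h ⊢
      have : 1 ≤ P.ρ * x / mu P := by rw [le_div_iff₀ hμ]; linarith
      rw [min_eq_right this, max_eq_left (by norm_num)]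
      ring
    · rw [abs_of_nonpos hx] at h ⊢
      have : P.ρ * x / mu P ≤ -1 := by rw [div_le_iff₀ hμ]; linarith
      rw [min_eq_left (by linarith), max_eq_right this]
      ring
  · push Not at h
    rw [lt_div_iff₀ hρ] at h
    have h1 := abs_lt.1 (show |P.ρ * x| < mu P by rw [abs_mul, abs_of_pos hρ]; linarith)
    have h2 : P.ρ * x / mu P ≤ 1 := by rw [div_le_iff₀ hμ]; linarith
    have h3 : -1 ≤ P.ρ * x / mu P := by rw [le_div_iff₀ hμ]; linarith
    rw [min_eq_left h2, max_eq_left h3]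
    field_simp
    ring

lemma smoothedPenalty_eq_huber (hP : P.Valid) (X : Matrix (Fin n) (Fin n) ℝ) :
    smoothedPenalty P X = ∑ i, ∑ j, huber P (X i j) := by
  simp only [smoothedPenalty, prox₂, frob_apply, frobSq_apply, Finset.mul_sum, Finset.sum_div,
    ← Finset.sum_sub_distrib, huber_eq hP, clipU, Matrix.of_apply]

lemma frob_le_sum_abs {n : ℕ} (X : Matrix (Fin n) (Fin n) ℝ) {U : Matrix (Fin n) (Fin n) ℝ}
    (hU : U ∈ Q₂ n) : frob X U ≤ ∑ i, ∑ j, |X i j| := by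
  rw [frob_apply]
  refine Finset.sum_le_sum fun i _ => Finset.sum_le_sum fun j _ => ?_
  refine (le_abs_self _).trans ?_
  rw [abs_mul]
  exact mul_le_of_le_one_right (abs_nonneg _) (hU.2 i j)

lemma prox₂_nonneg (U : Matrix (Fin n) (Fin n) ℝ) : 0 ≤ prox₂ U :=
  div_nonneg (frobSq_nonneg U) zero_le_two

lemma smoothed_le_objective (hP : P.Valid) {X : Matrix (Fin n) (Fin n) ℝ} (hX : X.IsSymm) :
    smoothed P X ≤ objective P X := by
  have h1 := mul_le_mul_of_nonneg_left (frob_le_sum_abs X (clipU_mem (P := P) hX)) hP.ρ_pos.le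
  have h2 := mul_nonneg (mu_pos hP).le (prox₂_nonneg (clipU P X))
  rw [smoothed_eq hP hX, smoothedPenalty, objective]
  linarith

lemma objective_le_smoothed (hP : P.Valid) {X : Matrix (Fin n) (Fin n) ℝ} (hX : X.IsSymm) :
    objective P X ≤ smoothed P X + P.ε / 2 := by
  -- the sign pattern of `X` attains the maximum that defines the penalty
  have hV : (Matrix.of fun i j => (SignType.sign (X i j) : ℝ)) ∈ Q₂ n := by
    refine ⟨by ext i j; simp [hX.apply i j], fun i j => ?_⟩
    rcases lt_trichotomy (X i j) 0 with h | h | h <;> simp [h]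
  have h1 := le_smoothedPenalty hP X hV
  have h2 : frob X (Matrix.of fun i j => (SignType.sign (X i j) : ℝ)) = ∑ i, ∑ j, |X i j| := by
    rw [frob_apply]
    simp
  have h3 := mul_le_mul_of_nonneg_left ((prox₂_isGreatest n).2 ⟨_, hV, rfl⟩) (mu_pos hP).le
  rw [← D₂_eq, mu_mul_D₂ hP] at h3
  rw [smoothed_eq hP hX, objective]
  rw [h2] at h1
  linarith

lemma smoothedPenalty_lower (hP : P.Valid) {X : Matrix (Fin n) (Fin n) ℝ} (hX : X.IsSymm)
    (Y : Matrix (Fin n) (Fin n) ℝ) :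
    smoothedPenalty P X + frob (P.ρ • clipU P X) (Y - X) ≤ smoothedPenalty P Y := by
  have h := le_smoothedPenalty hP Y (clipU_mem (P := P) hX)
  rw [frob_smul_left, map_sub, frob_comm _ Y, frob_comm _ X, smoothedPenalty]
  linarith

lemma smoothedPenalty_upper (hP : P.Valid) (X : Matrix (Fin n) (Fin n) ℝ)
    {Y : Matrix (Fin n) (Fin n) ℝ} (hY : Y.IsSymm) :
    smoothedPenalty P Y ≤ smoothedPenalty P X + frob (P.ρ • clipU P X) (Y - X) +
      P.ρ ^ 2 / mu P / 2 * frobSq (Y - X) := by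
  have hμ := mu_pos hP
  have h := clipU_optimal hP X (clipU_mem (P := P) hY)
  have h2 := mul_le_mul_of_nonneg_left
    -- the weights that complete the square with the quadratic growth `h`
    (frob_le_frobSq ((P.ρ / mu P) • (Y - X)) (clipU P Y - clipU P X)) (half_pos hμ).le
  rw [frob_smul_left, frobSq_smul] at h2
  have e1 : mu P / 2 * (2 * (P.ρ / mu P * frob (Y - X) (clipU P Y - clipU P X))) =
      P.ρ * frob (Y - X) (clipU P Y - clipU P X) := by field_simp
  have e2 : mu P / 2 * ((P.ρ / mu P) ^ 2 * frobSq (Y - X) + frobSq (clipU P Y - clipU P X)) =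
      P.ρ ^ 2 / mu P / 2 * frobSq (Y - X) + mu P / 2 * frobSq (clipU P Y - clipU P X) := by
    field_simp
  rw [e1, e2, map_sub, frob_sub_left, frob_sub_left] at h2
  rw [frob_smul_left, map_sub, frob_comm _ Y, frob_comm _ X, smoothedPenalty, smoothedPenalty]
  linarith

/-! ### The smoothed objective -/

lemma lipM_pos (hP : P.Valid) : 0 < lipM P := by
  have := hP.α_pos
  rw [lipM]; positivity

lemma lipL_eq (hP : P.Valid) : lipL P = lipM P + P.ρ ^ 2 / mu P := by
  have := D₂_pos hP; have := hP.ε_pos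
  rw [lipL, σ₂, normA, mu]
  field_simp

lemma lipL_pos (hP : P.Valid) : 0 < lipL P := by
  have := mu_pos hP; have := lipM_pos hP
  rw [lipL_eq hP]; positivity

lemma gradForm_isSymm (hP : P.Valid) {X : Matrix (Fin n) (Fin n) ℝ} (hX : X.IsSymm) :
    (gradForm P X).IsSymm :=
  ((inv_isSymm hX).neg.add hP.symm).add ((clipU_mem hX).1.smul _)

lemma smoothed_lower (hP : P.Valid) {X Y : Matrix (Fin n) (Fin n) ℝ} (hX : X ∈ Q₁ P)
    (hY : Y ∈ Q₁ P) : smoothed P X + frob (gradForm P X) (Y - X) ≤ smoothed P Y := by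
  have h1 := smoothPart_lower hP.α_pos hX hY
  have h2 := smoothedPenalty_lower hP (isSymm_of_mem_Q₁ hX) Y
  rw [smoothed_eq hP (isSymm_of_mem_Q₁ hX), smoothed_eq hP (isSymm_of_mem_Q₁ hY), gradForm,
    frob_add_left (-X⁻¹ + P.S)]
  linarith

lemma smoothed_upper (hP : P.Valid) {X Y : Matrix (Fin n) (Fin n) ℝ} (hX : X ∈ Q₁ P)
    (hY : Y ∈ Q₁ P) : smoothed P Y ≤ smoothed P X + stepObj P (gradForm P X) X Y := by
  have h1 := smoothPart_upper hP.α_pos hX hY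
  have h2 := smoothedPenalty_upper hP X (isSymm_of_mem_Q₁ hY)
  rw [smoothed_eq hP (isSymm_of_mem_Q₁ hX), smoothed_eq hP (isSymm_of_mem_Q₁ hY), gradForm, stepObj,
    frob_add_left (-X⁻¹ + P.S), lipL_eq hP, add_div, add_mul]
  linarith

lemma hasGradOnSymm_smoothed (hP : P.Valid) {X : Matrix (Fin n) (Fin n) ℝ} (hX : X ∈ Q₁ P) :
    HasGradOnSymm (smoothed P) (gradForm P X) X := by
  have hXs := isSymm_of_mem_Q₁ hX
  refine hasGradOnSymm_of_quadratic_error (K := 1 / (2 * (P.α / 2) ^ 2) + P.ρ ^ 2 / mu P / 2)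
    (gradForm_isSymm hP hXs) (half_pos hP.α_pos) fun Y hY hYX => ?_
  have h1 := abs_le.1 (smoothPart_quadratic_error hP.α_pos hX hY hYX)
  have h2 := smoothedPenalty_lower hP hXs Y
  have h3 := smoothedPenalty_upper hP X hY
  have h4 : 0 ≤ P.ρ ^ 2 / mu P / 2 * frobSq (Y - X) := by linarith
  rw [smoothed_eq hP hXs, smoothed_eq hP hY, gradForm, frob_add_left (-X⁻¹ + P.S), add_mul, abs_le]
  constructor <;> linarith

/-- `U*` is Lipschitz with constant `ρ / μ`: scaling by `ρ / μ` is followed by clipping, which does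
not increase distances. -/
lemma frobSq_clipU_sub_le (X Y : Matrix (Fin n) (Fin n) ℝ) :
    frobSq (clipU P X - clipU P Y) ≤ (P.ρ / mu P) ^ 2 * frobSq (X - Y) := by
  simp only [frobSq_apply, Finset.mul_sum]
  refine Finset.sum_le_sum fun i _ => Finset.sum_le_sum fun j _ => ?_
  rw [← mul_pow, sq_le_sq]
  simp only [Matrix.sub_apply, clipU, Matrix.of_apply]
  refine (abs_max_sub_max_le_abs _ _ _).trans ((abs_min_sub_min_le_max _ _ _ _).trans ?_)
  rw [sub_self, abs_zero, max_eq_left (abs_nonneg _)]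
  exact le_of_eq (congrArg _ (by ring))

/-- Lipschitz constants of two maps add up, by the triangle inequality for the Frobenius norm. -/
lemma frobSq_add_le {A B : Matrix (Fin n) (Fin n) ℝ} {p q s : ℝ} (hp : 0 < p) (hq : 0 < q)
    (hA : frobSq A ≤ p ^ 2 * s) (hB : frobSq B ≤ q ^ 2 * s) :
    frobSq (A + B) ≤ (p + q) ^ 2 * s := by
  have h := frob_le_frobSq (q • A) (p • B)
  rw [frob_smul_left, frob_smul_right, frobSq_smul, frobSq_smul] at h
  have h1 := mul_le_mul_of_nonneg_left hA (sq_nonneg q)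
  have h2 := mul_le_mul_of_nonneg_left hB (sq_nonneg p)
  have h3 : p * q * (2 * frob A B) ≤ p * q * (2 * (p * q) * s) := by linarith
  have h4 := le_of_mul_le_mul_left h3 (mul_pos hp hq)
  have e : frobSq (A + B) = frobSq A + 2 * frob A B + frobSq B := by
    simp only [frobSq, frob_add_left, map_add, frob_comm B A]; ring
  rw [e]
  linarith

lemma sqrt_frobSq_le {A B : Matrix (Fin n) (Fin n) ℝ} {p : ℝ} (hp : 0 ≤ p)
    (h : frobSq A ≤ p ^ 2 * frobSq B) : √(frobSq A) ≤ p * √(frobSq B) := by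
  rw [← Real.sqrt_sq hp, ← Real.sqrt_mul (sq_nonneg p)]
  exact Real.sqrt_le_sqrt h

lemma gradForm_lipschitz (hP : P.Valid) {X Y : Matrix (Fin n) (Fin n) ℝ} (hX : X ∈ Q₁ P)
    (hY : Y ∈ Q₁ P) :
    √(frobSq (gradForm P X - gradForm P Y)) ≤ lipL P * √(frobSq (X - Y)) := by
  have hμ := mu_pos hP
  have hρ := hP.ρ_pos
  refine sqrt_frobSq_le (lipL_pos hP).le ?_
  have e : gradForm P X - gradForm P Y =
      -(X⁻¹ - Y⁻¹) + P.ρ • (clipU P X - clipU P Y) := by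
    rw [gradForm, gradForm]; module
  rw [e, lipL_eq hP]
  refine frobSq_add_le (lipM_pos hP) (by positivity) ?_ ?_
  · rw [frobSq, frob_neg_left, map_neg, neg_neg]
    exact frobSq_inv_sub_inv_le hP.α_pos hX hY
  · rw [frobSq_smul]
    refine (mul_le_mul_of_nonneg_left (frobSq_clipU_sub_le X Y) (sq_nonneg _)).trans
      (le_of_eq (by ring))

lemma smoothPart_grad_lipschitz (hP : P.Valid) {X Y : Matrix (Fin n) (Fin n) ℝ} (hX : X ∈ Q₁ P)
    (hY : Y ∈ Q₁ P) :
    √(frobSq ((-X⁻¹ + P.S) - (-Y⁻¹ + P.S))) ≤ lipM P * √(frobSq (X - Y)) := by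
  refine sqrt_frobSq_le (lipM_pos hP).le ?_
  have e : (-X⁻¹ + P.S) - (-Y⁻¹ + P.S) = -(X⁻¹ - Y⁻¹) := by module
  rw [e, frobSq, frob_neg_left, map_neg, neg_neg]
  exact frobSq_inv_sub_inv_le hP.α_pos hX hY

end Smoothing

section Scheme

variable {n : ℕ} {P : Data ℝ n}

/-! ### The dual function -/

/-- The Lagrangian at `U` is, up to a constant, the objective of the prox step for `S + ρ U`. -/
lemma lagrangian_eq (X U : Matrix (Fin n) (Fin n) ℝ) :
    smoothPart P X + P.ρ * frob X U =
      prox₁ P X + frob (P.S + P.ρ • U) X - n * Real.log P.β := by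
  rw [smoothPart, prox₁, frob_add_left, frob_smul_left, frob_comm U]
  ring

/-- The minimum that defines the dual function is attained at the explicit solution of the prox
step. -/
lemma lagrangian_isLeast (hP : P.Valid) {U V : Matrix (Fin n) (Fin n) ℝ} {d : Fin n → ℝ}
    (hB : IsEigenDecomp (P.S + P.ρ • U) V d) :
    IsLeast ((fun X => smoothPart P X + P.ρ * frob X U) '' Q₁ P)
      (smoothPart P (V * Matrix.diagonal (fun i => clipInv P (d i)) * V.transpose) +
        P.ρ * frob (V * Matrix.diagonal (fun i => clipInv P (d i)) * V.transpose) U) := by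
  have h := isUniqueMinOn_prox hP.α_pos hP.α_le_β hB
  refine ⟨⟨_, h.1, rfl⟩, ?_⟩
  rintro _ ⟨X, hX, rfl⟩
  simp only [lagrangian_eq]
  rcases eq_or_ne X (V * Matrix.diagonal (fun i => clipInv P (d i)) * V.transpose) with rfl | hne
  · exact le_rfl
  · have := h.2 X hX hne
    simp only at this
    linarith

lemma isLeast_dualFun (hP : P.Valid) {U : Matrix (Fin n) (Fin n) ℝ} (hU : U.IsSymm) :
    IsLeast ((fun X => smoothPart P X + P.ρ * frob X U) '' Q₁ P) (dualFun P U) := by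
  obtain ⟨V, d, hB⟩ := exists_isEigenDecomp (hP.symm.add (hU.smul P.ρ))
  have h := lagrangian_isLeast hP hB
  rwa [dualFun, h.csInf_eq]

/-- Weak duality. -/
lemma dualFun_le_objective (hP : P.Valid) {U X : Matrix (Fin n) (Fin n) ℝ} (hU : U ∈ Q₂ n)
    (hX : X ∈ Q₁ P) : dualFun P U ≤ objective P X := by
  refine ((isLeast_dualFun hP hU.1).2 ⟨X, hX, rfl⟩).trans ?_
  have := mul_le_mul_of_nonneg_left (frob_le_sum_abs X hU) hP.ρ_pos.le
  simp only [objective]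
  linarith

/-! ### The accelerated scheme -/

lemma IsUniqueMinOn.eq_of_isMinOn {E : Type} {f : E → ℝ} {s : Set E} {x y : E}
    (h : IsUniqueMinOn f s x) (hy : y ∈ s) (hmin : IsMinOn f s y) : y = x := by
  by_contra hne
  exact absurd (hmin h.1) (not_le.2 (h.2 y hy hne))

lemma scaled_prox_eq (hP : P.Valid) (W Z : Matrix (Fin n) (Fin n) ℝ) :
    lipL P * prox₁ P Z / σ₁ P + frob W Z =
      lipL P / σ₁ P * (prox₁ P Z + frob ((σ₁ P / lipL P) • W) Z) := by
  have h1 := lipL_pos hP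
  have h2 := σ₁_pos hP.α_pos hP.α_le_β
  rw [frob_smul_left]
  field_simp

lemma isUniqueMinOn_scaled_prox (hP : P.Valid) {W V : Matrix (Fin n) (Fin n) ℝ} {d : Fin n → ℝ}
    (hB : IsEigenDecomp ((σ₁ P / lipL P) • W) V d) :
    IsUniqueMinOn (fun Z => lipL P * prox₁ P Z / σ₁ P + frob W Z) (Q₁ P)
      (V * Matrix.diagonal (fun i => clipInv P (d i)) * V.transpose) := by
  have h := isUniqueMinOn_prox hP.α_pos hP.α_le_β hB
  refine ⟨h.1, fun Z hZ hne => ?_⟩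
  simp only [scaled_prox_eq hP]
  exact mul_lt_mul_of_pos_left (h.2 Z hZ hne)
    (div_pos (lipL_pos hP) (σ₁_pos hP.α_pos hP.α_le_β))

/-- The objective of the estimate-sequence step is strongly convex with parameter `L`. -/
lemma scaled_prox_growth (hP : P.Valid) {W C Z : Matrix (Fin n) (Fin n) ℝ} (hW : W.IsSymm)
    (hC : C ∈ Q₁ P) (hZ : Z ∈ Q₁ P)
    (hmin : IsMinOn (fun Z => lipL P * prox₁ P Z / σ₁ P + frob W Z) (Q₁ P) C) :
    lipL P * prox₁ P C / σ₁ P + frob W C + lipL P / 2 * frobSq (Z - C) ≤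
      lipL P * prox₁ P Z / σ₁ P + frob W Z := by
  obtain ⟨V, d, hB⟩ := exists_isEigenDecomp (hW.smul (σ₁ P / lipL P))
  have h := (isUniqueMinOn_scaled_prox hP hB).eq_of_isMinOn hC hmin
  have hσ := σ₁_pos hP.α_pos hP.α_le_β
  have hg := mul_le_mul_of_nonneg_left (prox_growth hP.α_pos hP.α_le_β hB hZ)
    (div_pos (lipL_pos hP) hσ).le
  rw [← h] at hg
  rw [scaled_prox_eq hP, scaled_prox_eq hP]
  refine le_trans (le_of_eq ?_) hg
  field_simp

/-- Growth of the prox-function from its minimizer `β I` over `Q₁`, which is the solution of the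
prox step for `B = 0`. -/
lemma prox₁_center (hP : P.Valid) {Z : Matrix (Fin n) (Fin n) ℝ} (hZ : Z ∈ Q₁ P) :
    σ₁ P / 2 * frobSq (Z - P.β • (1 : Matrix (Fin n) (Fin n) ℝ)) ≤ prox₁ P Z := by
  have h0 : IsEigenDecomp (0 : Matrix (Fin n) (Fin n) ℝ) 1 (fun _ => 0) := by
    simpa using isEigenDecomp_smul_one (n := n) 0
  have h := prox_growth hP.α_pos hP.α_le_β h0 hZ
  have e : (1 : Matrix (Fin n) (Fin n) ℝ) * Matrix.diagonal (fun _ => clipInv P 0) *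
      (1 : Matrix (Fin n) (Fin n) ℝ).transpose = P.β • (1 : Matrix (Fin n) (Fin n) ℝ) := by
    rw [clipInv, if_pos le_rfl]
    exact (isEigenDecomp_smul_one P.β).2.2.symm
  have e0 : ∀ Y, frob (0 : Matrix (Fin n) (Fin n) ℝ) Y = 0 := fun Y => by simp [frob_apply]
  rw [e, e0, e0, prox₁_smul_one (hP.α_pos.trans_le hP.α_le_β)] at h
  linarith

lemma convexComb_mem_Q₂ {A B : Matrix (Fin n) (Fin n) ℝ} (hA : A ∈ Q₂ n) (hB : B ∈ Q₂ n) {s t : ℝ}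
    (hs : 0 ≤ s) (ht : 0 ≤ t) (hst : s + t = 1) : s • A + t • B ∈ Q₂ n := by
  refine ⟨(hA.1.smul s).add (hB.1.smul t), fun i j => ?_⟩
  have h1 := abs_le.1 (hA.2 i j)
  have h2 := abs_le.1 (hB.2 i j)
  simp only [Matrix.add_apply, Matrix.smul_apply, smul_eq_mul]
  rw [abs_le]
  constructor <;> nlinarith

/-- The weighted sum of the gradients seen up to step `k`. -/
noncomputable def gradSum (G : ℕ → Matrix (Fin n) (Fin n) ℝ) (k : ℕ) :
    Matrix (Fin n) (Fin n) ℝ :=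
  ∑ i ∈ Finset.range (k + 1), (((i : ℝ) + 1) / 2) • G i

lemma frob_gradSum (G : ℕ → Matrix (Fin n) (Fin n) ℝ) (k : ℕ) (Z : Matrix (Fin n) (Fin n) ℝ) :
    frob (gradSum G k) Z = ∑ i ∈ Finset.range (k + 1), ((i : ℝ) + 1) / 2 * frob (G i) Z := by
  rw [gradSum, frob_comm, map_sum]
  simp only [frob_comm Z, frob_smul_left]

lemma gradSum_isSymm {G : ℕ → Matrix (Fin n) (Fin n) ℝ} (hG : ∀ i, (G i).IsSymm) (k : ℕ) :
    (gradSum G k).IsSymm := by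
  rw [gradSum, Matrix.IsSymm, Matrix.transpose_sum]
  exact Finset.sum_congr rfl fun i _ => (hG i).smul _

lemma estimateObj_eq (X G : ℕ → Matrix (Fin n) (Fin n) ℝ) (k : ℕ)
    (Z : Matrix (Fin n) (Fin n) ℝ) :
    estimateObj P X G k Z = lipL P * prox₁ P Z / σ₁ P + frob (gradSum G k) Z +
      ∑ i ∈ Finset.range (k + 1), ((i : ℝ) + 1) / 2 * (smoothed P (X i) - frob (G i) (X i)) := by
  rw [estimateObj, frob_gradSum, add_assoc, ← Finset.sum_add_distrib]
  congr 1
  refine Finset.sum_congr rfl fun i _ => ?_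
  rw [map_sub]
  ring

lemma estimateObj_succ (X G : ℕ → Matrix (Fin n) (Fin n) ℝ) (k : ℕ)
    (Z : Matrix (Fin n) (Fin n) ℝ) :
    estimateObj P X G (k + 1) Z = estimateObj P X G k Z +
      ((k : ℝ) + 2) / 2 * (smoothed P (X (k + 1)) + frob (G (k + 1)) (Z - X (k + 1))) := by
  rw [estimateObj, Finset.sum_range_succ, ← add_assoc, estimateObj]
  push_cast
  ring

section Run

variable {X G U Y Z Uh : ℕ → Matrix (Fin n) (Fin n) ℝ}

lemma IsScheme.query_mem (hP : P.Valid) (h : IsScheme P X G U Y Z Uh) (k : ℕ) : X k ∈ Q₁ P := by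
  cases k with
  | zero => rw [h.start]; exact smul_one_mem_Q₁ hP.α_le_β le_rfl
  | succ k =>
    rw [h.update]
    exact convexComb_mem_Q₁ (h.estimate_mem k) (h.primal_mem k) (by positivity) (by positivity)
      (by field_simp; ring)

/-- A gradient on the space of symmetric matrices is unique, so that any sequence `G` of the scheme
consists of the explicit gradients. -/
lemma IsScheme.grad_eq (hP : P.Valid) (h : IsScheme P X G U Y Z Uh) (k : ℕ) :
    G k = gradForm P (X k) :=
  hasGradOnSymm_unique (isSymm_of_mem_Q₁ (h.query_mem hP k)) (h.grad k)
    (hasGradOnSymm_smoothed hP (h.query_mem hP k))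

lemma IsScheme.argmax_eq (hP : P.Valid) (h : IsScheme P X G U Y Z Uh) (k : ℕ) :
    U k = clipU P (X k) :=
  (isUniqueMinOn_clipU hP (isSymm_of_mem_Q₁ (h.query_mem hP k))).eq_of_isMinOn (h.argmax_mem k)
    (h.argmax k).neg

lemma IsScheme.dual_mem (h : IsScheme P X G U Y Z Uh) (k : ℕ) : Uh k ∈ Q₂ n := by
  induction k with
  | zero => rw [h.dual_zero]; exact h.argmax_mem 0
  | succ k ih =>
    have e : Uh (k + 1) = (((k : ℝ) + 1) / (k + 3)) • Uh k + (2 / ((k : ℝ) + 3)) • U (k + 1) := by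
      rw [h.dual_succ, smul_add, smul_smul, smul_smul]
      congr 2 <;> ring
    rw [e]
    exact convexComb_mem_Q₂ ih (h.argmax_mem _) (by positivity) (by positivity)
      (by field_simp; ring)

lemma IsScheme.estimate_growth (hP : P.Valid) (h : IsScheme P X G U Y Z Uh) (k : ℕ)
    {C : Matrix (Fin n) (Fin n) ℝ} (hC : C ∈ Q₁ P) :
    estimateObj P X G k (Z k) + lipL P / 2 * frobSq (C - Z k) ≤ estimateObj P X G k C := by
  have hmin : IsMinOn (fun Z => lipL P * prox₁ P Z / σ₁ P + frob (gradSum G k) Z) (Q₁ P) (Z k) := by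
    intro C hC
    have := h.estimate k hC
    simp only [Set.mem_ofPred_eq, estimateObj_eq, add_le_add_iff_right] at this
    exact this
  have hg := scaled_prox_growth hP (gradSum_isSymm (fun i => (h.grad i).1) k) (h.estimate_mem k) hC
    hmin
  rw [estimateObj_eq, estimateObj_eq]
  linarith

/-- The primal step decreases the smoothed objective at least as much as the quadratic model
predicts at any point of `Q₁`. -/
lemma IsScheme.smoothed_primal_le (hP : P.Valid) (h : IsScheme P X G U Y Z Uh) (k : ℕ)
    {C : Matrix (Fin n) (Fin n) ℝ} (hC : C ∈ Q₁ P) :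
    smoothed P (Y k) ≤ smoothed P (X k) + stepObj P (G k) (X k) C := by
  have h1 := smoothed_upper hP (h.query_mem hP k) (h.primal_mem k)
  have h2 : stepObj P (G k) (X k) (Y k) ≤ stepObj P (G k) (X k) C := h.primal k hC
  rw [← h.grad_eq hP] at h1
  linarith

/-- The estimate-sequence inequality `A_k f_ε(Y_k) ≤ min ψ_k` with `A_k = (k + 1) (k + 2) / 4`. -/
lemma IsScheme.estimate_sequence (hP : P.Valid) (h : IsScheme P X G U Y Z Uh) (k : ℕ) :
    ((k : ℝ) + 1) * (k + 2) / 4 * smoothed P (Y k) ≤ estimateObj P X G k (Z k) := by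
  have hL := lipL_pos hP
  have hσ := σ₁_pos hP.α_pos hP.α_le_β
  induction k with
  | zero =>
    have h1 := h.smoothed_primal_le hP 0 (h.estimate_mem 0)
    have h2 := mul_le_mul_of_nonneg_left (prox₁_center hP (h.estimate_mem 0)) (div_pos hL hσ).le
    have e : lipL P / σ₁ P * (σ₁ P / 2 * frobSq (Z 0 - P.β • (1 : Matrix (Fin n) (Fin n) ℝ))) =
        lipL P / 2 * frobSq (Z 0 - X 0) := by
      rw [h.start]; field_simp
    rw [e] at h2
    have h3 := mul_nonneg hL.le (frobSq_nonneg (Z 0 - X 0))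
    rw [stepObj] at h1
    simp only [estimateObj, zero_add, Finset.sum_range_one, Nat.cast_zero]
    have e2 : lipL P * prox₁ P (Z 0) / σ₁ P = lipL P / σ₁ P * prox₁ P (Z 0) := by ring
    rw [e2]
    linarith
  | succ k ih =>
    set C := (2 / ((k : ℝ) + 3)) • Z (k + 1) + (((k : ℝ) + 1) / (k + 3)) • Y k with hCdef
    have hC : C ∈ Q₁ P := convexComb_mem_Q₁ (h.estimate_mem _) (h.primal_mem k) (by positivity)
      (by positivity) (by field_simp; ring)
    have hk : (0 : ℝ) ≤ k := Nat.cast_nonneg k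
    have h1 := h.estimate_growth hP k (h.estimate_mem (k + 1))
    have h2 := smoothed_lower hP (h.query_mem hP (k + 1)) (h.primal_mem k)
    rw [← h.grad_eq hP] at h2
    have h3 := h.smoothed_primal_le hP (k + 1) hC
    -- `C` is the query point with `Z k` replaced by `Z (k + 1)`
    have e1 : C - X (k + 1) = (2 / ((k : ℝ) + 3)) • (Z (k + 1) - Z k) := by
      rw [hCdef, h.update]; module
    -- the query point is the barycentre of `Y k` and `Z k` with the weights of the estimate
    have e2 : frob (G (k + 1)) (Z (k + 1) - X (k + 1)) = frob (G (k + 1)) (Z (k + 1) - Z k) -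
        ((k : ℝ) + 1) / 2 * frob (G (k + 1)) (Y k - X (k + 1)) := by
      rw [h.update]
      simp only [map_sub, map_add, frob_smul_right]
      field_simp
      ring
    rw [stepObj, e1, frob_smul_right, frobSq_smul] at h3
    rw [estimateObj_succ, e2]
    push_cast
    set g := frob (G (k + 1)) (Z (k + 1) - Z k)
    set q := frobSq (Z (k + 1) - Z k) with hq
    have hq0 : 0 ≤ q := frobSq_nonneg _
    have h4 := mul_le_mul_of_nonneg_left h3
      (show 0 ≤ ((k : ℝ) + 2) * (k + 3) / 4 by positivity)
    have h5 := mul_le_mul_of_nonneg_left h2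
      (show 0 ≤ ((k : ℝ) + 1) * (k + 2) / 4 by positivity)
    have e3 : ((k : ℝ) + 2) * (k + 3) / 4 * (smoothed P (X (k + 1)) +
        (2 / ((k : ℝ) + 3) * g + lipL P / 2 * ((2 / ((k : ℝ) + 3)) ^ 2 * q))) =
        ((k : ℝ) + 2) * (k + 3) / 4 * smoothed P (X (k + 1)) + ((k : ℝ) + 2) / 2 * g +
          ((k : ℝ) + 2) / (k + 3) * (lipL P / 2 * q) := by
      field_simp
      ring
    have h6 : ((k : ℝ) + 2) / (k + 3) * (lipL P / 2 * q) ≤ lipL P / 2 * q :=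
      mul_le_of_le_one_left (by positivity) (by rw [div_le_one (by positivity)]; linarith)
    rw [e3] at h4
    have e4 : ((k : ℝ) + 1 + 1) * (k + 1 + 2) / 4 = ((k : ℝ) + 2) * (k + 3) / 4 := by ring
    rw [e4]
    linarith

/-- The dual iterate is the average of the inner maximizers with the weights of the estimate. -/
lemma IsScheme.smul_dual_eq (h : IsScheme P X G U Y Z Uh) (k : ℕ) :
    (((k : ℝ) + 1) * (k + 2) / 4) • Uh k = gradSum U k := by
  induction k with
  | zero => rw [gradSum, h.dual_zero]; simp; norm_num
  | succ k ih =>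
    rw [gradSum, Finset.sum_range_succ, ← gradSum, ← ih, h.dual_succ, smul_smul, smul_add,
      smul_smul, smul_smul]
    push_cast
    congr 2 <;> (field_simp; ring)

/-- Linearizations of the smoothed objective lie below the Lagrangian at the inner maximizer. -/
lemma IsScheme.linearization_le (hP : P.Valid) (h : IsScheme P X G U Y Z Uh) (i : ℕ)
    {C : Matrix (Fin n) (Fin n) ℝ} (hC : C ∈ Q₁ P) :
    smoothed P (X i) + frob (G i) (C - X i) ≤ smoothPart P C + P.ρ * frob (U i) C := by
  have hX := h.query_mem hP i
  have h1 := smoothPart_lower hP.α_pos hX hC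
  have h2 := mul_nonneg (mu_pos hP).le (prox₂_nonneg (clipU P (X i)))
  rw [h.grad_eq hP, h.argmax_eq hP, smoothed_eq hP (isSymm_of_mem_Q₁ hX), gradForm,
    frob_add_left (-(X i)⁻¹ + P.S), frob_smul_left, map_sub (frob (clipU P (X i))), smoothedPenalty,
    frob_comm (X i)]
  linarith

/-- The duality gap of the smoothed objective after `k + 1` iterations. -/
lemma IsScheme.smoothed_gap (hP : P.Valid) (h : IsScheme P X G U Y Z Uh) (k : ℕ) :
    ((k : ℝ) + 1) * (k + 2) / 4 * (smoothed P (Y k) - dualFun P (Uh k)) ≤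
      lipL P * D₁ P / σ₁ P := by
  obtain ⟨C, hC, hCd⟩ := (isLeast_dualFun hP (h.dual_mem k).1).1
  have hL := lipL_pos hP
  have hσ := σ₁_pos hP.α_pos hP.α_le_β
  have h1 := h.estimate_sequence hP k
  have h2 : estimateObj P X G k (Z k) ≤ estimateObj P X G k C := h.estimate k hC
  have h3 : lipL P * prox₁ P C / σ₁ P ≤ lipL P * D₁ P / σ₁ P := by
    rw [D₁_eq hP.α_pos hP.α_le_β]
    have := (prox₁_isGreatest hP.α_pos hP.α_le_β).2 ⟨C, hC, rfl⟩
    gcongr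
  have h4 : ∑ i ∈ Finset.range (k + 1), ((i : ℝ) + 1) / 2 *
      (smoothed P (X i) + frob (G i) (C - X i)) ≤
      ∑ i ∈ Finset.range (k + 1), ((i : ℝ) + 1) / 2 * (smoothPart P C + P.ρ * frob (U i) C) :=
    Finset.sum_le_sum fun i _ =>
      mul_le_mul_of_nonneg_left (h.linearization_le hP i hC) (by positivity)
  have h5 : ∑ i ∈ Finset.range (k + 1), ((i : ℝ) + 1) / 2 = ((k : ℝ) + 1) * (k + 2) / 4 := by
    clear * -
    induction k with
    | zero => norm_num
    | succ k ih => rw [Finset.sum_range_succ, ih]; push_cast; ring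
  have h6 : ∑ i ∈ Finset.range (k + 1), ((i : ℝ) + 1) / 2 * (smoothPart P C + P.ρ * frob (U i) C) =
      ((k : ℝ) + 1) * (k + 2) / 4 * dualFun P (Uh k) := by
    have h7 := frob_gradSum U k C
    rw [← h.smul_dual_eq k, frob_smul_left] at h7
    simp only [mul_add, mul_left_comm _ P.ρ, Finset.sum_add_distrib, ← Finset.sum_mul,
      ← Finset.mul_sum, h5, ← h7, ← hCd, frob_comm C]
  rw [h6] at h4
  simp only [estimateObj] at h1 h2
  rw [mul_sub]
  linarith

/-! ### The number of iterations -/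

/-- The duality gap is at most `ε` once `(k + 1)²` exceeds `8 L D₁ / (σ₁ ε)`. -/
lemma IsScheme.gap_le (hP : P.Valid) (h : IsScheme P X G U Y Z Uh) (k : ℕ)
    (hk : 8 * (lipL P * D₁ P / σ₁ P) ≤ P.ε * ((k : ℝ) + 1) ^ 2) :
    objective P (Y k) - dualFun P (Uh k) ≤ P.ε := by
  have hε := hP.ε_pos
  have h1 := h.smoothed_gap hP k
  have h2 := objective_le_smoothed hP (isSymm_of_mem_Q₁ (h.primal_mem k))
  have hA : (0 : ℝ) < ((k : ℝ) + 1) * (k + 2) / 4 := by positivity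
  have h3 : ((k : ℝ) + 1) * (k + 2) / 4 * (smoothed P (Y k) - dualFun P (Uh k)) ≤
      ((k : ℝ) + 1) * (k + 2) / 4 * (P.ε / 2) := by
    have : 0 ≤ P.ε * ((k : ℝ) + 1) := by positivity
    linarith
  have h4 := le_of_mul_le_mul_left h3 hA
  linarith

end Run

lemma D₁_nonneg (hP : P.Valid) : 0 ≤ D₁ P := by
  rw [D₁_eq hP.α_pos hP.α_le_β]
  exact mul_nonneg (Nat.cast_nonneg n)
    (Real.log_nonneg ((one_le_div hP.α_pos).2 hP.α_le_β))

/-- Either condition on the number of iterations makes its square at least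
`8 L D₁ / (σ₁ ε) = a² + 8 b²`, where `iterBound t P = a + t b`; if `ε ≤ (n α ρ)² / 2`, then
`4 b ≤ a`, and already `(a + b)²` is large enough. -/
lemma lipL_le_of_iterBound_le (hP : P.Valid) {N : ℝ}
    (h : iterBound (2 * √2) P ≤ N ∨ (P.ε ≤ (n * P.α * P.ρ) ^ 2 / 2 ∧ iterBound 1 P ≤ N)) :
    8 * (lipL P * D₁ P / σ₁ P) ≤ P.ε * N ^ 2 := by
  have hε := hP.ε_pos
  have hρ := hP.ρ_pos
  have hα := hP.α_pos
  have hσ := σ₁_pos hP.α_pos hP.α_le_β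
  have hD1 := D₁_nonneg hP
  have hD2 := D₂_pos hP
  have hM := lipM_pos hP
  set a := 4 * normA P * (1 / P.ε) * √(D₁ P * D₂ n / (σ₁ P * σ₂)) with ha
  set b := √(lipM P * D₁ P / (σ₁ P * P.ε)) with hb
  have ha0 : 0 ≤ a := by rw [ha, normA]; positivity
  have hb0 : 0 ≤ b := Real.sqrt_nonneg _
  have ha2 : a ^ 2 = 16 * P.ρ ^ 2 * (D₁ P * D₂ n) / (σ₁ P * P.ε ^ 2) := by
    rw [ha, mul_pow, Real.sq_sqrt (by rw [σ₂]; positivity), normA, σ₂]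
    field_simp
    ring
  have hb2 : b ^ 2 = lipM P * D₁ P / (σ₁ P * P.ε) := Real.sq_sqrt (by positivity)
  have key : 8 * (lipL P * D₁ P / σ₁ P) = P.ε * (a ^ 2 + 8 * b ^ 2) := by
    rw [ha2, hb2, lipL, normA, σ₂]
    field_simp
    ring
  rw [key]
  refine mul_le_mul_of_nonneg_left ?_ hε.le
  rcases h with h | ⟨hs, h⟩
  · have h1 : a + 2 * √2 * b ≤ N := h
    have h2 : (a + 2 * √2 * b) ^ 2 ≤ N ^ 2 := by gcongr
    have h3 : (√2 : ℝ) ^ 2 = 2 := Real.sq_sqrt zero_le_two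
    have h4 : 0 ≤ a * (√2 * b) := by positivity
    have h5 : (√2 * b) ^ 2 = 2 * b ^ 2 := by rw [mul_pow, h3]
    nlinarith
  · have h1 : a + 1 * b ≤ N := h
    rw [one_mul] at h1
    have h2 : (a + b) ^ 2 ≤ N ^ 2 := by gcongr
    have h3 : (4 * b) ^ 2 ≤ a ^ 2 := by
      have h4 : P.ε * lipM P ≤ P.ρ ^ 2 * D₂ n := by
        rw [lipM, D₂_eq, mul_one_div, div_le_iff₀ (by positivity)]
        linarith
      have h5 : 16 * (P.ε * lipM P) * (D₁ P / (σ₁ P * P.ε ^ 2)) ≤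
          16 * (P.ρ ^ 2 * D₂ n) * (D₁ P / (σ₁ P * P.ε ^ 2)) := by gcongr
      rw [mul_pow, ha2, hb2]
      refine le_trans (le_of_eq ?_) (h5.trans (le_of_eq ?_))
      · field_simp; ring
      · ring
    have h6 : 4 * b ≤ a := le_of_sq_le_sq h3 ha0
    nlinarith

lemma iterBound_eq (hP : P.Valid) (t : ℝ) :
    iterBound t P = (P.β / P.α) * √(n * Real.log (P.β / P.α)) / P.ε *
      (2 * √2 * n * P.α * P.ρ + t * √P.ε) := by
  have hε := hP.ε_pos
  have hα := hP.α_pos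
  have hβ := hP.α_pos.trans_le hP.α_le_β
  have hD := D₁_nonneg hP
  have e1 : √(D₁ P * D₂ n / (σ₁ P * σ₂)) = √(D₁ P) * (n * P.β / √2) := by
    have : D₁ P * D₂ n / (σ₁ P * σ₂) = D₁ P * (n * P.β / √2) ^ 2 := by
      rw [D₂_eq, σ₁, σ₂, div_pow, Real.sq_sqrt zero_le_two]
      field_simp
    rw [this, Real.sqrt_mul hD, Real.sqrt_sq (by positivity)]
  have e2 : √(lipM P * D₁ P / (σ₁ P * P.ε)) = √(D₁ P) * (P.β / (P.α * √P.ε)) := by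
    have : lipM P * D₁ P / (σ₁ P * P.ε) = D₁ P * (P.β / (P.α * √P.ε)) ^ 2 := by
      rw [lipM, σ₁, div_pow, mul_pow, Real.sq_sqrt hε.le]
      field_simp
    rw [this, Real.sqrt_mul hD, Real.sqrt_sq (by positivity)]
  rw [iterBound, e1, e2, ← D₁_eq hP.α_pos hP.α_le_β, normA]
  have h2 : (√2 : ℝ) ^ 2 = 2 := Real.sq_sqrt zero_le_two
  have h3 : √P.ε ^ 2 = P.ε := Real.sq_sqrt hε.le
  have h4 : 0 < √P.ε := Real.sqrt_pos.2 hε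
  have e3 : (n : ℝ) * P.β / √2 = n * P.β * √2 / 2 := by
    rw [div_eq_div_iff (by positivity) two_ne_zero]
    linear_combination (-(n : ℝ) * P.β) * h2
  have e4 : P.β / (P.α * √P.ε) = P.β / P.α * √P.ε / P.ε := by
    rw [div_eq_div_iff (by positivity) hε.ne']
    field_simp
    linear_combination -h3
  rw [e3, e4]
  field_simp
  ring

/-- Accuracy of the primal iterate after sufficiently many iterations. -/
lemma IsScheme.accuracy (hP : P.Valid) {X G U Y Z Uh : ℕ → Matrix (Fin n) (Fin n) ℝ}
    (h : IsScheme P X G U Y Z Uh) (k : ℕ) (hk : objective P (Y k) - dualFun P (Uh k) ≤ P.ε)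
    {C : Matrix (Fin n) (Fin n) ℝ} (hC : C ∈ Q₁ P) : objective P (Y k) ≤ objective P C + P.ε := by
  have := dualFun_le_objective hP (h.dual_mem k) hC
  linarith

end Scheme

/-! ### Values computed by the program -/

section Values

@[simp] lemma Costed.val_bind {A B : Type} (x : Costed A) (f : A → Costed B) :
    (x >>= f).val = (f x.val).val := rfl

@[simp] lemma Costed.cost_bind {A B : Type} (x : Costed A) (f : A → Costed B) :
    (x >>= f).cost = x.cost + (f x.val).cost := rfl

@[simp] lemma Costed.val_pure {A : Type} (a : A) : (pure a : Costed A).val = a := rfl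

@[simp] lemma Costed.cost_pure {A : Type} (a : A) : (pure a : Costed A).cost = 0 := rfl

@[simp] lemma vecC_val {A : Type} {n : ℕ} (f : Fin n → Costed A) :
    (vecC f).val = fun i => (f i).val := rfl

@[simp] lemma vecC_cost {A : Type} {n : ℕ} (f : Fin n → Costed A) :
    (vecC f).cost = ∑ i, ((f i).cost + 1) := rfl

@[simp] lemma matC_val {A : Type} {n : ℕ} (f : Fin n → Fin n → Costed A) :
    (matC f).val = Matrix.of fun i j => (f i j).val := rfl

@[simp] lemma matC_cost {A : Type} {n : ℕ} (f : Fin n → Fin n → Costed A) :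
    (matC f).cost = ∑ i, ∑ j, ((f i j).cost + 1) := rfl

section Operations

variable (c : ℕ) (x y : ℝ)

@[simp] lemma realMachine_nat (k : ℕ) : (realMachine c).nat k = ⟨(k : ℝ), 1⟩ := rfl

@[simp] lemma realMachine_add : (realMachine c).add x y = ⟨x + y, 1⟩ := rfl

@[simp] lemma realMachine_sub : (realMachine c).sub x y = ⟨x - y, 1⟩ := rfl

@[simp] lemma realMachine_mul : (realMachine c).mul x y = ⟨x * y, 1⟩ := rfl

@[simp] lemma realMachine_div : (realMachine c).div x y = ⟨x / y, 1⟩ := rfl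

@[simp] lemma realMachine_min : (realMachine c).min x y = ⟨min x y, 1⟩ := rfl

@[simp] lemma realMachine_max : (realMachine c).max x y = ⟨max x y, 1⟩ := rfl

@[simp] lemma realMachine_log : (realMachine c).log x = ⟨Real.log x, 1⟩ := rfl

open Classical in
@[simp] lemma realMachine_le : (realMachine c).le x y = ⟨decide (x ≤ y), 1⟩ := rfl

@[simp] lemma realMachine_eig {n : ℕ} (B : Matrix (Fin n) (Fin n) ℝ) :
    (realMachine c).eig n B = ⟨eigReal n B, c * n ^ 3⟩ := rfl

end Operations

@[simp] lemma sumC_val (c : ℕ) {m : ℕ} (f : Fin m → Costed ℝ) :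
    (sumC (realMachine c) f).val = ∑ i, (f i).val := by
  induction m with
  | zero => simp [sumC]
  | succ m ih =>
    rw [Fin.sum_univ_castSucc, ← ih]
    rfl

@[simp] lemma sumC_cost (c : ℕ) {m : ℕ} (f : Fin m → Costed ℝ) :
    (sumC (realMachine c) f).cost = 1 + ∑ i, ((f i).cost + 1) := by
  induction m with
  | zero => simp [sumC]
  | succ m ih =>
    rw [Fin.sum_univ_castSucc, ← add_assoc, ← ih]
    rfl

variable {n : ℕ} {P : Data ℝ n} (c : ℕ)

lemma spectralC_val (V : Matrix (Fin n) (Fin n) ℝ) (d : Fin n → ℝ) :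
    (spectralC (realMachine c) V d).val = V * Matrix.diagonal d * V.transpose := by
  ext i j
  simp [spectralC, Matrix.mul_apply (M := V * _), Matrix.mul_diagonal]

lemma innerC_val (A B : Matrix (Fin n) (Fin n) ℝ) :
    (innerC (realMachine c) A B).val = frob A B := by
  simp [innerC, frob_apply]

lemma eigReal_mem {X : Matrix (Fin n) (Fin n) ℝ} (hX : X ∈ Q₁ P) (i : Fin n) :
    P.α ≤ (eigReal n X).1 i ∧ (eigReal n X).1 i ≤ P.β :=
  ((isEigenDecomp_eigReal (isSymm_of_mem_Q₁ hX)).mem_Q₁_iff P).1 hX i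

lemma invC_val (hα : 0 < P.α) {X : Matrix (Fin n) (Fin n) ℝ} (hX : X ∈ Q₁ P) :
    (invC (realMachine c) X).val = X⁻¹ := by
  have h := (isEigenDecomp_eigReal (isSymm_of_mem_Q₁ hX)).inv
    fun i => (hα.trans_le (eigReal_mem hX i).1).ne'
  rw [h.2.2, ← spectralC_val c]
  simp [invC]

lemma logDetC_val (hα : 0 < P.α) {X : Matrix (Fin n) (Fin n) ℝ} (hX : X ∈ Q₁ P) :
    (logDetC (realMachine c) X).val = Real.log X.det := by
  rw [(isEigenDecomp_eigReal (isSymm_of_mem_Q₁ hX)).log_det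
    fun i => hα.trans_le (eigReal_mem hX i).1]
  simp [logDetC]

lemma muC_val : (muC (realMachine c) P).val = mu P := by
  simp [muC, d2C, mu, D₂_eq, sq]

lemma lipC_val : (lipC (realMachine c) P).val = lipL P := by
  simp [lipC, d2C, lipL, lipM, σ₂, normA, D₂_eq, sq]

lemma clipC_val (X : Matrix (Fin n) (Fin n) ℝ) :
    (clipC (realMachine c) P X).val = clipU P X := by
  ext i j
  have h := muC_val (P := P) c
  simp only [clipC, Costed.val_bind, matC_val, Matrix.of_apply, clipU, h]
  simp

lemma step1C_val (hα : 0 < P.α) {X : Matrix (Fin n) (Fin n) ℝ} (hX : X ∈ Q₁ P) :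
    (step1C (realMachine c) P X).val = (gradForm P X, clipU P X) := by
  simp only [step1C, Costed.val_bind, matC_val, Costed.val_pure, clipC_val, invC_val c hα hX]
  congr 1
  ext i j
  simp only [realMachine, Matrix.of_apply, gradForm, Matrix.add_apply, Matrix.neg_apply,
    Matrix.smul_apply, smul_eq_mul]
  ring

lemma projC_val (B : Matrix (Fin n) (Fin n) ℝ) :
    (projC (realMachine c) P B).val = (eigReal n B).2 *
      Matrix.diagonal (fun i => clipEig P ((eigReal n B).1 i)) * (eigReal n B).2.transpose := by
  simp only [projC, Costed.val_bind, spectralC_val]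
  rfl

lemma proxC_val (B : Matrix (Fin n) (Fin n) ℝ) :
    (proxC (realMachine c) P B).val = (eigReal n B).2 *
      Matrix.diagonal (fun i => clipInv P ((eigReal n B).1 i)) * (eigReal n B).2.transpose := by
  simp only [proxC, Costed.val_bind, spectralC_val, vecC_val, clipInv]
  congr 3
  ext i
  simp only [realMachine, Nat.cast_zero, Nat.cast_one, decide_eq_true_eq]
  split_ifs <;> rfl

/-- The gradient step is a projection: its objective is, up to a constant, a multiple of the squared
distance to `X - L⁻¹ G`. -/
lemma stepObj_eq (hP : P.Valid) (G X Y : Matrix (Fin n) (Fin n) ℝ) :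
    stepObj P G X Y = lipL P / 2 * frobSq (Y - (X - (1 / lipL P) • G)) -
      frobSq G / (2 * lipL P) := by
  have hL := lipL_pos hP
  have e : Y - (X - (1 / lipL P) • G) = (Y - X) - (-(1 / lipL P)) • G := by module
  rw [e, frobSq_sub, frobSq_smul, frob_smul_right, stepObj, frob_comm (Y - X)]
  field_simp
  ring

lemma step2C_val (X G : Matrix (Fin n) (Fin n) ℝ) :
    (step2C (realMachine c) P X G).val =
      (projC (realMachine c) P (X - (1 / lipL P) • G)).val := by
  have e : X - (1 / lipL P) • G = Matrix.of fun i j => X i j - G i j / lipL P := by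
    ext i j
    simp only [Matrix.sub_apply, Matrix.smul_apply, smul_eq_mul, Matrix.of_apply]
    ring
  simp only [step2C, Costed.val_bind, lipC_val, matC_val, e]
  rfl

lemma step2C_isUniqueMinOn (hP : P.Valid) {X G : Matrix (Fin n) (Fin n) ℝ} (hX : X.IsSymm)
    (hG : G.IsSymm) :
    IsUniqueMinOn (fun Y => frobSq (Y - (X - (1 / lipL P) • G))) (Q₁ P)
      (step2C (realMachine c) P X G).val := by
  rw [step2C_val, projC_val]
  exact isUniqueMinOn_proj hP.α_le_β (isEigenDecomp_eigReal (hX.sub (hG.smul _)))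

lemma step2C_isUniqueMinOn_stepObj (hP : P.Valid) {X G : Matrix (Fin n) (Fin n) ℝ}
    (hX : X.IsSymm) (hG : G.IsSymm) :
    IsUniqueMinOn (stepObj P G X) (Q₁ P) (step2C (realMachine c) P X G).val := by
  have h := step2C_isUniqueMinOn c hP hX hG
  refine ⟨h.1, fun Y hY hne => ?_⟩
  rw [stepObj_eq hP, stepObj_eq hP]
  exact sub_lt_sub_right (mul_lt_mul_of_pos_left (h.2 Y hY hne) (half_pos (lipL_pos hP))) _

lemma step3C_val (W : Matrix (Fin n) (Fin n) ℝ) :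
    (step3C (realMachine c) P W).val =
      (proxC (realMachine c) P ((σ₁ P / lipL P) • W)).val := by
  have e : (σ₁ P / lipL P) • W = Matrix.of fun i j => W i j / (P.β * P.β * lipL P) := by
    ext i j
    simp only [Matrix.smul_apply, smul_eq_mul, Matrix.of_apply, σ₁]
    rw [div_div, one_div_mul_eq_div, sq]
  simp only [step3C, Costed.val_bind, lipC_val, matC_val, e]
  rfl

lemma step3C_isUniqueMinOn (hP : P.Valid) {W : Matrix (Fin n) (Fin n) ℝ} (hW : W.IsSymm) :
    IsUniqueMinOn (fun Z => lipL P * prox₁ P Z / σ₁ P + frob W Z) (Q₁ P)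
      (step3C (realMachine c) P W).val := by
  rw [step3C_val, proxC_val]
  exact isUniqueMinOn_scaled_prox hP (isEigenDecomp_eigReal (hW.smul _))

lemma dualC_val (hP : P.Valid) {U : Matrix (Fin n) (Fin n) ℝ} (hU : U.IsSymm) :
    (dualC (realMachine c) P U).val = dualFun P U := by
  have e : (Matrix.of fun i j => P.S i j + P.ρ * U i j) = P.S + P.ρ • U := by
    ext i j
    simp
  have hB := isEigenDecomp_eigReal (hP.symm.add (hU.smul P.ρ))
  have hX := (isUniqueMinOn_prox hP.α_pos hP.α_le_β hB).1
  rw [dualFun, (lagrangian_isLeast hP hB).csInf_eq, ← proxC_val c]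
  rw [← proxC_val c] at hX
  have h : (dualC (realMachine c) P U).val =
      (innerC (realMachine c) (P.S + P.ρ • U) (proxC (realMachine c) P (P.S + P.ρ • U)).val).val -
        (logDetC (realMachine c) (proxC (realMachine c) P (P.S + P.ρ • U)).val).val := by
    rw [← e]
    rfl
  rw [h, innerC_val, logDetC_val c hP.α_pos hX, smoothPart, frob_add_left, frob_smul_left,
    frob_comm U]
  ring

lemma objC_val (hα : 0 < P.α) {Y : Matrix (Fin n) (Fin n) ℝ} (hY : Y ∈ Q₁ P) :
    (objC (realMachine c) P Y).val = objective P Y := by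
  simp only [objC, Costed.val_bind, sumC_val, innerC_val, logDetC_val c hα hY]
  simp only [realMachine, Nat.cast_zero, zero_sub, objective, smoothPart, abs, neg_add_eq_sub]

lemma gapC_val (hP : P.Valid) {Y U : Matrix (Fin n) (Fin n) ℝ} (hY : Y ∈ Q₁ P) (hU : U ∈ Q₂ n) :
    (gapC (realMachine c) P Y U).val = objective P Y - dualFun P U := by
  simp only [gapC, Costed.val_bind, objC_val c hP.α_pos hY, dualC_val c hP hU.1]
  rfl

end Values

/-! ### The cost of the program -/

section Costs

variable {n : ℕ} (P : Data ℝ n) (c : ℕ)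

lemma spectralC_cost (hn : 1 ≤ n) (V : Matrix (Fin n) (Fin n) ℝ) (d : Fin n → ℝ) :
    (spectralC (realMachine c) V d).cost ≤ 5 * n ^ 3 := by
  have h2 : n ^ 2 ≤ n ^ 3 := Nat.pow_le_pow_right hn (by norm_num)
  simp [spectralC]
  linarith

lemma innerC_cost (hn : 1 ≤ n) (A B : Matrix (Fin n) (Fin n) ℝ) :
    (innerC (realMachine c) A B).cost ≤ 5 * n ^ 3 := by
  have h0 : 1 ≤ n ^ 3 := Nat.one_le_pow _ _ hn
  have h1 : n ≤ n ^ 3 := Nat.le_self_pow (by norm_num) n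
  have h2 : n ^ 2 ≤ n ^ 3 := Nat.pow_le_pow_right hn (by norm_num)
  simp [innerC]
  linarith

lemma invC_cost (hn : 1 ≤ n) (X : Matrix (Fin n) (Fin n) ℝ) :
    (invC (realMachine c) X).cost ≤ (c + 8) * n ^ 3 := by
  have h0 : 1 ≤ n ^ 3 := Nat.one_le_pow _ _ hn
  have h1 : n ≤ n ^ 3 := Nat.le_self_pow (by norm_num) n
  have hs := spectralC_cost c hn
  simp only [invC, Costed.cost_bind]
  refine (add_le_add le_rfl (add_le_add le_rfl (add_le_add le_rfl (hs _ _)))).trans ?_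
  simp
  linarith

lemma logDetC_cost (hn : 1 ≤ n) (X : Matrix (Fin n) (Fin n) ℝ) :
    (logDetC (realMachine c) X).cost ≤ (c + 3) * n ^ 3 := by
  have h0 : 1 ≤ n ^ 3 := Nat.one_le_pow _ _ hn
  have h1 : n ≤ n ^ 3 := Nat.le_self_pow (by norm_num) n
  simp [logDetC]
  linarith

lemma muC_cost : (muC (realMachine c) P).cost = 7 := by
  simp [muC, d2C]

lemma lipC_cost : (lipC (realMachine c) P).cost = 13 := by
  simp [lipC, d2C]

lemma clipC_cost (hn : 1 ≤ n) (X : Matrix (Fin n) (Fin n) ℝ) :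
    (clipC (realMachine c) P X).cost ≤ 15 * n ^ 3 := by
  have h0 : 1 ≤ n ^ 3 := Nat.one_le_pow _ _ hn
  have h2 : n ^ 2 ≤ n ^ 3 := Nat.pow_le_pow_right hn (by norm_num)
  simp only [clipC, Costed.cost_bind, muC_cost, matC_cost]
  simp
  linarith

lemma step1C_cost (hn : 1 ≤ n) (X : Matrix (Fin n) (Fin n) ℝ) :
    (step1C (realMachine c) P X).cost ≤ (c + 27) * n ^ 3 := by
  have h2 : n ^ 2 ≤ n ^ 3 := Nat.pow_le_pow_right hn (by norm_num)
  have hU := clipC_cost P c hn X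
  have hW := invC_cost c hn X
  simp only [step1C, Costed.cost_bind, matC_cost, Costed.cost_pure]
  generalize (clipC (realMachine c) P X).cost = a at *
  generalize (invC (realMachine c) X).cost = b at *
  simp
  linarith

lemma projC_cost (hn : 1 ≤ n) (B : Matrix (Fin n) (Fin n) ℝ) :
    (projC (realMachine c) P B).cost ≤ (c + 8) * n ^ 3 := by
  have h1 : n ≤ n ^ 3 := Nat.le_self_pow (by norm_num) n
  have hs := spectralC_cost c hn
  simp only [projC, Costed.cost_bind]
  refine (add_le_add le_rfl (add_le_add le_rfl (hs _ _))).trans ?_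
  simp
  linarith

lemma step2C_cost (hn : 1 ≤ n) (X G : Matrix (Fin n) (Fin n) ℝ) :
    (step2C (realMachine c) P X G).cost ≤ (c + 24) * n ^ 3 := by
  have h0 : 1 ≤ n ^ 3 := Nat.one_le_pow _ _ hn
  have h2 : n ^ 2 ≤ n ^ 3 := Nat.pow_le_pow_right hn (by norm_num)
  simp only [step2C, Costed.cost_bind, lipC_cost]
  refine (add_le_add le_rfl (add_le_add le_rfl (projC_cost P c hn _))).trans ?_
  simp
  linarith

lemma proxC_cost (hn : 1 ≤ n) (B : Matrix (Fin n) (Fin n) ℝ) :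
    (proxC (realMachine c) P B).cost ≤ (c + 12) * n ^ 3 := by
  have h0 : 1 ≤ n ^ 3 := Nat.one_le_pow _ _ hn
  have h1 : n ≤ n ^ 3 := Nat.le_self_pow (by norm_num) n
  have hs := spectralC_cost c hn
  simp only [proxC, Costed.cost_bind, vecC_cost]
  refine (add_le_add le_rfl (add_le_add le_rfl (add_le_add le_rfl
    -- the longer branch has a comparison and three operations, and the entry is stored
    (add_le_add (Finset.sum_le_sum (g := fun _ => 5) fun i _ => ?_) (hs _ _))))).trans ?_
  · split_ifs <;> simp
  · simp
    linarith

lemma step3C_cost (hn : 1 ≤ n) (W : Matrix (Fin n) (Fin n) ℝ) :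
    (step3C (realMachine c) P W).cost ≤ (c + 29) * n ^ 3 := by
  have h0 : 1 ≤ n ^ 3 := Nat.one_le_pow _ _ hn
  have h2 : n ^ 2 ≤ n ^ 3 := Nat.pow_le_pow_right hn (by norm_num)
  simp only [step3C, Costed.cost_bind, lipC_cost]
  refine (add_le_add le_rfl (add_le_add le_rfl (add_le_add le_rfl (add_le_add le_rfl
    (proxC_cost P c hn _))))).trans ?_
  simp
  linarith

lemma dualC_cost (hn : 1 ≤ n) (U : Matrix (Fin n) (Fin n) ℝ) :
    (dualC (realMachine c) P U).cost ≤ (2 * c + 24) * n ^ 3 := by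
  have h0 : 1 ≤ n ^ 3 := Nat.one_le_pow _ _ hn
  have h2 : n ^ 2 ≤ n ^ 3 := Nat.pow_le_pow_right hn (by norm_num)
  simp only [dualC, Costed.cost_bind]
  refine (add_le_add le_rfl (add_le_add (proxC_cost P c hn _) (add_le_add (logDetC_cost c hn _)
    (add_le_add (innerC_cost c hn _ _) le_rfl)))).trans ?_
  simp
  linarith

lemma objC_cost (hn : 1 ≤ n) (Y : Matrix (Fin n) (Fin n) ℝ) :
    (objC (realMachine c) P Y).cost ≤ (c + 18) * n ^ 3 := by
  have h0 : 1 ≤ n ^ 3 := Nat.one_le_pow _ _ hn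
  have h1 : n ≤ n ^ 3 := Nat.le_self_pow (by norm_num) n
  have h2 : n ^ 2 ≤ n ^ 3 := Nat.pow_le_pow_right hn (by norm_num)
  simp only [objC, Costed.cost_bind, sumC_cost]
  refine (add_le_add (logDetC_cost c hn _) (add_le_add (innerC_cost c hn _ _) le_rfl)).trans ?_
  simp
  linarith

lemma gapC_cost (hn : 1 ≤ n) (Y U : Matrix (Fin n) (Fin n) ℝ) :
    (gapC (realMachine c) P Y U).cost ≤ (3 * c + 43) * n ^ 3 := by
  have h0 : 1 ≤ n ^ 3 := Nat.one_le_pow _ _ hn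
  simp only [gapC, Costed.cost_bind]
  refine (add_le_add (objC_cost P c hn _) (add_le_add (dualC_cost P c hn _) le_rfl)).trans ?_
  simp
  linarith

lemma iterC_cost (hn : 1 ≤ n) (k : ℕ) (s : State ℝ n) :
    (iterC (realMachine c) P k s).cost ≤ (6 * c + 150) * n ^ 3 := by
  have h0 : 1 ≤ n ^ 3 := Nat.one_le_pow _ _ hn
  have h2 : n ^ 2 ≤ n ^ 3 := Nat.pow_le_pow_right hn (by norm_num)
  -- the three entrywise updates, with at most four units per entry besides the storing
  have hm : ∀ f : Fin n → Fin n → Costed ℝ, (∀ i j, (f i j).cost ≤ 4) →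
      (matC f).cost ≤ 5 * n ^ 3 := by
    intro f hf
    have h : ∑ i, ∑ j, ((f i j).cost + 1) ≤ ∑ _i : Fin n, ∑ _j : Fin n, 5 :=
      Finset.sum_le_sum fun i _ => Finset.sum_le_sum fun j _ => Nat.succ_le_succ (hf i j)
    simp only [Finset.sum_const, Finset.card_univ, Fintype.card_fin, smul_eq_mul] at h
    rw [matC_cost]
    linarith
  simp only [iterC, Costed.cost_bind, Costed.cost_pure]
  refine (add_le_add (step1C_cost P c hn _) (add_le_add (step2C_cost P c hn _ _)
    (add_le_add (b := 1) (le_of_eq rfl) (add_le_add (b := 1) (le_of_eq rfl)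
    (add_le_add (b := 1) (le_of_eq rfl) (add_le_add (b := 1) (le_of_eq rfl)
    (add_le_add (b := 1) (le_of_eq rfl) (add_le_add (b := 1) (le_of_eq rfl)
    (add_le_add (b := 1) (le_of_eq rfl) (add_le_add (b := 1) (le_of_eq rfl)
    (add_le_add (hm _ fun i j => ?_) (add_le_add (step3C_cost P c hn _)
    (add_le_add (b := 1) (le_of_eq rfl) (add_le_add (b := 1) (le_of_eq rfl)
    (add_le_add (hm _ fun i j => ?_) (add_le_add (hm _ fun i j => ?_)
    (add_le_add (gapC_cost P c hn _ _) (add_le_add (b := 1) (le_of_eq rfl)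
    le_rfl)))))))))))))))))).trans ?_
  · simp
  · simp
  · simp
  · linarith

lemma initC_cost (hn : 1 ≤ n) : (initC (realMachine c) P).cost ≤ 4 * n ^ 3 := by
  have h0 : 1 ≤ n ^ 3 := Nat.one_le_pow _ _ hn
  have h2 : n ^ 2 ≤ n ^ 3 := Nat.pow_le_pow_right hn (by norm_num)
  have h : ∀ i j : Fin n, (if i = j then (pure P.β : Costed ℝ) else pure 0).cost = 0 := by
    intro i j
    split_ifs <;> rfl
  simp [initC, h]
  linarith

lemma runC_cost (hn : 1 ≤ n) (T : ℕ) :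
    (runC (realMachine c) P T).cost ≤ 4 * n ^ 3 + (6 * c + 150) * n ^ 3 * T := by
  induction T with
  | zero => simpa [runC] using initC_cost P c hn
  | succ T ih =>
    simp only [runC, Costed.cost_bind]
    have := iterC_cost P c hn T (runC (realMachine c) P T).val
    rw [Nat.mul_succ]
    omega

/-- The first iteration absorbs the cost of the initialization. -/
lemma runC_cost_of_pos (hn : 1 ≤ n) {T : ℕ} (hT : 1 ≤ T) :
    (runC (realMachine c) P T).cost ≤ (6 * c + 154) * n ^ 3 * T := by
  have h1 := runC_cost P c hn T
  have h2 := Nat.mul_le_mul_left (4 * n ^ 3) hT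
  linarith

end Costs

/-! ### The program runs the scheme -/

section Program

variable {n : ℕ} (P : Data ℝ n) (c : ℕ)

/-- The memory of the program after `k` iterations in exact real arithmetic. -/
noncomputable def runState (k : ℕ) : State ℝ n := (runC (realMachine c) P k).val

lemma runState_G (k : ℕ) :
    (runState P c (k + 1)).G = (step1C (realMachine c) P (runState P c k).X).val.1 := rfl

lemma runState_U (k : ℕ) :
    (runState P c (k + 1)).U = (step1C (realMachine c) P (runState P c k).X).val.2 := rfl

lemma runState_X_zero : (runState P c 0).X = P.β • (1 : Matrix (Fin n) (Fin n) ℝ) := by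
  ext i j
  rcases eq_or_ne i j with h | h <;> simp [runState, runC, initC, h]

lemma runState_W_zero : (runState P c 0).W = 0 := by
  ext i j
  simp [runState, runC, initC]

lemma runState_W (k : ℕ) : (runState P c (k + 1)).W =
    (runState P c k).W + (((k : ℝ) + 1) / 2) • (runState P c (k + 1)).G := by
  ext i j
  simp [runState, runC, iterC]

lemma runState_X (k : ℕ) : (runState P c (k + 1)).X =
    (2 / ((k : ℝ) + 3)) • (runState P c (k + 1)).Z +
      (((k : ℝ) + 1) / (k + 3)) • (runState P c (k + 1)).Y := by
  ext i j
  simp [runState, runC, iterC]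

lemma runState_Uh (k : ℕ) : (runState P c (k + 1)).Uh =
    (1 / ((k : ℝ) + 2)) • ((k : ℝ) • (runState P c k).Uh +
      (2 : ℝ) • (runState P c (k + 1)).U) := by
  ext i j
  simp [runState, runC, iterC]
  ring

lemma runState_done_zero : (runState P c 0).done = false := rfl

lemma runState_done (k : ℕ) : (runState P c (k + 1)).done = true ↔
    (gapC (realMachine c) P (runState P c (k + 1)).Y (runState P c (k + 1)).Uh).val ≤ P.ε := by
  have : (runState P c (k + 1)).done = ((realMachine c).le (gapC (realMachine c) P
      (runState P c (k + 1)).Y (runState P c (k + 1)).Uh).val P.ε).val := rfl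
  rw [this, realMachine_le, decide_eq_true_eq]

variable {P}

lemma runState_invariant (hP : P.Valid) (k : ℕ) :
    (runState P c k).X ∈ Q₁ P ∧ (runState P c k).W.IsSymm := by
  induction k with
  | zero =>
    rw [runState_X_zero, runState_W_zero]
    exact ⟨smul_one_mem_Q₁ hP.α_le_β le_rfl, Matrix.transpose_zero⟩
  | succ k ih =>
    have hX := isSymm_of_mem_Q₁ ih.1
    have hG : (runState P c (k + 1)).G.IsSymm := by
      rw [runState_G, step1C_val c hP.α_pos ih.1]
      exact gradForm_isSymm hP hX
    have hW : (runState P c (k + 1)).W.IsSymm := by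
      rw [runState_W]
      exact ih.2.add (hG.smul _)
    refine ⟨?_, hW⟩
    rw [runState_X]
    exact convexComb_mem_Q₁ (step3C_isUniqueMinOn c hP hW).1
      (step2C_isUniqueMinOn c hP hX hG).1 (by positivity) (by positivity) (by field_simp; ring)

lemma runState_W_eq_gradSum (k : ℕ) :
    (runState P c (k + 1)).W = gradSum (fun k => (runState P c (k + 1)).G) k := by
  induction k with
  | zero => rw [runState_W, runState_W_zero, gradSum]; simp
  | succ k ih => rw [runState_W, ih, gradSum, gradSum, Finset.sum_range_succ _ (k + 1)]

lemma IsUniqueMinOn.isMinOn {E : Type} {f : E → ℝ} {s : Set E} {x : E}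
    (h : IsUniqueMinOn f s x) : IsMinOn f s x := by
  intro y hy
  rcases eq_or_ne y x with rfl | hne
  · exact le_refl (f y)
  · exact (h.2 y hy hne).le

lemma isScheme_runState (hP : P.Valid) :
    IsScheme P (fun k => (runState P c k).X) (fun k => (runState P c (k + 1)).G)
      (fun k => (runState P c (k + 1)).U) (fun k => (runState P c (k + 1)).Y)
      (fun k => (runState P c (k + 1)).Z) (fun k => (runState P c (k + 1)).Uh) := by
  have hX := fun k => (runState_invariant c hP k).1
  have hXs := fun k => isSymm_of_mem_Q₁ (hX k)
  have hG : ∀ k, (runState P c (k + 1)).G = gradForm P (runState P c k).X := fun k => by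
    rw [runState_G, step1C_val c hP.α_pos (hX k)]
  have hU : ∀ k, (runState P c (k + 1)).U = clipU P (runState P c k).X := fun k => by
    rw [runState_U, step1C_val c hP.α_pos (hX k)]
  have hY := fun k => step2C_isUniqueMinOn_stepObj c hP (hXs k)
    (show (runState P c (k + 1)).G.IsSymm from hG k ▸ gradForm_isSymm hP (hXs k))
  have hZ := fun k => step3C_isUniqueMinOn c hP (runState_invariant c hP (k + 1)).2
  refine ⟨runState_X_zero P c, fun k => ?_, fun k => ?_, fun k => ?_, fun k => (hY k).1,
    fun k => (hY k).isMinOn, fun k => (hZ k).1, fun k => ?_, runState_X P c, ?_, fun k => ?_⟩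
  · rw [hG]
    exact hasGradOnSymm_smoothed hP (hX k)
  · rw [hU]
    exact clipU_mem (hXs k)
  · have := (isUniqueMinOn_clipU hP (hXs k)).isMinOn.neg
    simp only [neg_neg] at this
    rwa [hU]
  · intro C hC
    have h := (hZ k).isMinOn hC
    simp only [Set.mem_ofPred_eq] at h
    simp only [Set.mem_ofPred_eq, estimateObj_eq, add_le_add_iff_right]
    rwa [← runState_W_eq_gradSum]
  · rw [runState_Uh]
    simp
  · rw [runState_Uh]
    push_cast
    congr 2
    ring

lemma runState_done_iff (hP : P.Valid) (k : ℕ) : (runState P c (k + 1)).done = true ↔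
    objective P (runState P c (k + 1)).Y - dualFun P (runState P c (k + 1)).Uh ≤ P.ε := by
  have h := isScheme_runState c hP
  rw [runState_done, gapC_val c hP (h.primal_mem k) (h.dual_mem k)]

/-! ### Termination and total cost -/

lemma one_le_of_stopsAfter {T : ℕ} (h : StopsAfter (realMachine c) P T) : 1 ≤ T := by
  rcases Nat.eq_zero_or_pos T with rfl | hT
  · have h0 : (runState P c 0).done = true := h.1
    rw [runState_done_zero] at h0
    exact absurd h0 (by decide)
  · exact hT

lemma stopsAfter_unique {T T' : ℕ} (h : StopsAfter (realMachine c) P T)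
    (h' : StopsAfter (realMachine c) P T') : T = T' := by
  rcases lt_trichotomy T T' with hlt | heq | hlt
  · have := h'.2 T hlt
    rw [h.1] at this
    exact absurd this (by decide)
  · exact heq
  · have := h.2 T' hlt
    rw [h'.1] at this
    exact absurd this (by decide)

/-- The stopping test succeeds at iteration `max 1 ⌈N⌉` if `N` is at least one of the two iteration
bounds. -/
lemma runState_done_of_iterBound (hP : P.Valid) {N : ℝ}
    (h : iterBound (2 * √2) P ≤ N ∨ (P.ε ≤ (n * P.α * P.ρ) ^ 2 / 2 ∧ iterBound 1 P ≤ N)) :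
    (runC (realMachine c) P (max 1 ⌈N⌉₊)).val.done = true := by
  obtain ⟨k, hk⟩ : ∃ k, max 1 ⌈N⌉₊ = k + 1 := ⟨max 1 ⌈N⌉₊ - 1, by omega⟩
  have hN : N ≤ (k : ℝ) + 1 := by
    refine (Nat.le_ceil N).trans ?_
    have h1 : ⌈N⌉₊ ≤ k + 1 := hk ▸ le_max_right _ _
    exact_mod_cast h1
  rw [hk]
  refine (runState_done_iff c hP k).2 ((isScheme_runState c hP).gap_le hP k ?_)
  exact lipL_le_of_iterBound_le hP (h.imp hN.trans' fun h => ⟨h.1, h.2.trans hN⟩)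

lemma exists_stopsAfter (hP : P.Valid) : ∃ T, StopsAfter (realMachine c) P T ∧
    ∀ m, (runC (realMachine c) P m).val.done = true → T ≤ m := by
  classical
  have hex : ∃ m, (runC (realMachine c) P m).val.done = true :=
    ⟨_, runState_done_of_iterBound c hP (Or.inl le_rfl)⟩
  exact ⟨Nat.find hex, ⟨Nat.find_spec hex, fun m hm => Bool.eq_false_iff.2 (Nat.find_min hex hm)⟩,
    fun m hm => Nat.find_min' hex hm⟩

lemma runState_accuracy (hP : P.Valid) {T : ℕ} (hT : StopsAfter (realMachine c) P T) :
    (runState P c T).Y ∈ Q₁ P ∧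
      ∀ C ∈ Q₁ P, objective P (runState P c T).Y ≤ objective P C + P.ε := by
  obtain ⟨k, rfl⟩ : ∃ k, T = k + 1 := ⟨T - 1, by have := one_le_of_stopsAfter c hT; omega⟩
  have h := isScheme_runState c hP
  exact ⟨h.primal_mem k, fun C hC => h.accuracy hP k ((runState_done_iff c hP k).1 hT.1) hC⟩

/-- The total cost with the dependence on `n` and `ε` made explicit; the bound `1 ≤ ε₀ / ε` absorbs
the rounding of the number of iterations. -/
lemma runC_cost_le (hP : P.Valid) {ε₀ : ℝ} (hε₀ : P.ε ≤ ε₀) {T : ℕ}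
    (hT : StopsAfter (realMachine c) P T) :
    ((runC (realMachine c) P T).cost : ℝ) ≤ ((6 * c + 154) *
      ((P.β / P.α) * √(Real.log (P.β / P.α)) * (2 * √2 * P.α * P.ρ + 2 * √2 * √ε₀) + ε₀)) *
        (n : ℝ) ^ (9 / 2 : ℝ) / P.ε := by
  have hε := hP.ε_pos
  have hα := hP.α_pos
  have hρ := hP.ρ_pos
  have hβ := hα.trans_le hP.α_le_β
  have hn1 : (1 : ℝ) ≤ n := by exact_mod_cast hP.dim_pos
  have hn0 : (0 : ℝ) < n := one_pos.trans_le hn1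
  have hcost : ((runC (realMachine c) P T).cost : ℝ) ≤ (6 * c + 154) * n ^ 3 * T := by
    exact_mod_cast runC_cost_of_pos P c hP.dim_pos (one_le_of_stopsAfter c hT)
  obtain ⟨T', hT', hmin⟩ := exists_stopsAfter c hP
  have hTN : (T : ℝ) ≤ iterBound (2 * √2) P + 1 := by
    have h1 : T ≤ max 1 ⌈iterBound (2 * √2) P⌉₊ :=
      stopsAfter_unique c hT hT' ▸ hmin _ (runState_done_of_iterBound c hP (Or.inl le_rfl))
    have h0 : 0 ≤ iterBound (2 * √2) P := by
      have := D₂_pos hP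
      rw [iterBound_eq hP]
      positivity
    have h2 : ((max 1 ⌈iterBound (2 * √2) P⌉₊ : ℕ) : ℝ) ≤ iterBound (2 * √2) P + 1 := by
      rw [Nat.cast_max, Nat.cast_one]
      exact max_le (by linarith) (Nat.ceil_lt_add_one h0).le
    exact le_trans (by exact_mod_cast h1) h2
  have hpow : (n : ℝ) ^ (9 / 2 : ℝ) = n ^ 3 * (n * √n) := by
    rw [Real.sqrt_eq_rpow, ← Real.rpow_natCast, ← Real.rpow_one_add' hn0.le (by norm_num),
      ← Real.rpow_add hn0]
    norm_num
  have hs1 : (1 : ℝ) ≤ √n := Real.one_le_sqrt.2 hn1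
  have hN : iterBound (2 * √2) P + 1 ≤ ((P.β / P.α) * √(Real.log (P.β / P.α)) *
      (2 * √2 * P.α * P.ρ + 2 * √2 * √ε₀) + ε₀) * (n * √n) / P.ε := by
    have h1 : 2 * √2 * n * P.α * P.ρ + 2 * √2 * √P.ε ≤
        (2 * √2 * P.α * P.ρ + 2 * √2 * √ε₀) * n := by
      have : √P.ε ≤ √ε₀ * n :=
        (Real.sqrt_le_sqrt hε₀).trans (le_mul_of_one_le_right (Real.sqrt_nonneg _) hn1)
      have h2 : 2 * √2 * √P.ε ≤ 2 * √2 * (√ε₀ * n) := by gcongr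
      linarith
    have h3 : 1 ≤ ε₀ * (n * √n) / P.ε := by
      rw [le_div_iff₀ hε, one_mul]
      exact hε₀.trans (le_mul_of_one_le_right (hε.le.trans hε₀)
        (one_le_mul_of_one_le_of_one_le hn1 hs1))
    have h4 : P.β / P.α * √(n * Real.log (P.β / P.α)) / P.ε *
        (2 * √2 * n * P.α * P.ρ + 2 * √2 * √P.ε) ≤
        P.β / P.α * √(n * Real.log (P.β / P.α)) / P.ε *
        ((2 * √2 * P.α * P.ρ + 2 * √2 * √ε₀) * n) := by gcongr
    rw [iterBound_eq hP, add_mul, add_div]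
    refine add_le_add (h4.trans (le_of_eq ?_)) h3
    rw [Real.sqrt_mul hn0.le]
    ring
  rw [hpow]
  refine hcost.trans ((mul_le_mul_of_nonneg_left (hTN.trans hN) (by positivity)).trans
    (le_of_eq (by ring)))

end Program

end SparseML

theorem mainTheorem3 (c : ℕ) :
    -- `C₀` is absolute, except that it depends on the price of an eigenvalue decomposition
    (∃ C₀ : ℕ, ∀ (n : ℕ) (P : Data ℝ n), P.Valid →
      -- parameters of the format
      (IsGreatest (prox₁ P '' Q₁ P) (D₁ P) ∧ D₁ P = n * Real.log (P.β / P.α) ∧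
        IsGreatest (prox₂ '' Q₂ n) (D₂ n) ∧ D₂ n = (n : ℝ) ^ 2 / 2 ∧
        (∀ X ∈ Q₁ P, ∀ X' ∈ Q₁ P, ∀ t ∈ Set.Icc (0 : ℝ) 1,
          prox₁ P (t • X + (1 - t) • X') ≤ t * prox₁ P X + (1 - t) * prox₁ P X' -
            σ₁ P / 2 * t * (1 - t) * frobSq (X - X')) ∧
        (∀ X ∈ Q₁ P, HasGradOnSymm (smoothPart P) (-X⁻¹ + P.S) X) ∧
        (∀ X ∈ Q₁ P, ∀ X' ∈ Q₁ P,
          √(frobSq ((-X⁻¹ + P.S) - (-X'⁻¹ + P.S))) ≤ lipM P * √(frobSq (X - X')))) ∧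
      -- smoothing
      (∀ X ∈ Q₁ P, smoothed P X ≤ objective P X ∧ objective P X ≤ smoothed P X + P.ε / 2) ∧
      (∀ X ∈ Q₁ P, ∀ X' ∈ Q₁ P,
        √(frobSq (gradForm P X - gradForm P X')) ≤ lipL P * √(frobSq (X - X'))) ∧
      -- step 1: Huber form, maximizer, gradient, cost
      (∀ X ∈ Q₁ P,
        smoothed P X = smoothPart P X + ∑ i, ∑ j, huber P (X i j) ∧
        IsUniqueMinOn (fun U => -(P.ρ * frob X U - mu P * prox₂ U)) (Q₂ n) (clipU P X) ∧
        HasGradOnSymm (smoothed P) (gradForm P X) X ∧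
        (step1C (realMachine c) P X).val = (gradForm P X, clipU P X) ∧
        (step1C (realMachine c) P X).cost ≤ C₀ * n ^ 3) ∧
      -- step 2: projection by eigenvalue clipping, cost
      (∀ (B V : Matrix (Fin n) (Fin n) ℝ) (d : Fin n → ℝ), IsEigenDecomp B V d →
        IsUniqueMinOn (fun Y => frobSq (Y - B)) (Q₁ P)
          (V * Matrix.diagonal (fun i => clipEig P (d i)) * V.transpose)) ∧
      (∀ X ∈ Q₁ P, ∀ G : Matrix (Fin n) (Fin n) ℝ, G.IsSymm →
        IsUniqueMinOn (fun Y => frobSq (Y - (X - (1 / lipL P) • G))) (Q₁ P)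
          (step2C (realMachine c) P X G).val ∧
        IsUniqueMinOn (stepObj P G X) (Q₁ P) (step2C (realMachine c) P X G).val ∧
        (step2C (realMachine c) P X G).cost ≤ C₀ * n ^ 3) ∧
      -- step 3: prox step by clipping inverse eigenvalues, cost
      (∀ (B V : Matrix (Fin n) (Fin n) ℝ) (d : Fin n → ℝ), IsEigenDecomp B V d →
        IsUniqueMinOn (fun Z => prox₁ P Z + frob B Z) (Q₁ P)
          (V * Matrix.diagonal (fun i => clipInv P (d i)) * V.transpose)) ∧
      (∀ W : Matrix (Fin n) (Fin n) ℝ, W.IsSymm →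
        IsUniqueMinOn (fun Z => lipL P * prox₁ P Z / σ₁ P + frob W Z) (Q₁ P)
          (step3C (realMachine c) P W).val ∧
        (step3C (realMachine c) P W).cost ≤ C₀ * n ^ 3) ∧
      -- stopping test: the duality gap, cost
      (∀ Y ∈ Q₁ P, ∀ U ∈ Q₂ n,
        IsLeast ((fun X => smoothPart P X + P.ρ * frob X U) '' Q₁ P) (dualFun P U) ∧
        (gapC (realMachine c) P Y U).val = objective P Y - dualFun P U ∧
        (gapC (realMachine c) P Y U).cost ≤ C₀ * n ^ 3) ∧
      -- one iteration
      (∀ (k : ℕ) (s : State ℝ n), (iterC (realMachine c) P k s).cost ≤ C₀ * n ^ 3) ∧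
      -- the program runs the scheme
      (IsScheme P (fun k => (runC (realMachine c) P k).val.X)
        (fun k => (runC (realMachine c) P (k + 1)).val.G)
        (fun k => (runC (realMachine c) P (k + 1)).val.U)
        (fun k => (runC (realMachine c) P (k + 1)).val.Y)
        (fun k => (runC (realMachine c) P (k + 1)).val.Z)
        (fun k => (runC (realMachine c) P (k + 1)).val.Uh) ∧
        ∀ k, ((runC (realMachine c) P (k + 1)).val.done = true ↔
          objective P (runC (realMachine c) P (k + 1)).val.Y -
            dualFun P (runC (realMachine c) P (k + 1)).val.Uh ≤ P.ε)) ∧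
      -- explicit values of the iteration bounds
      iterBound (2 * √2) P =
        (P.β / P.α) * √(n * Real.log (P.β / P.α)) / P.ε *
          (2 * √2 * n * P.α * P.ρ + 2 * √2 * √P.ε) ∧
      iterBound 1 P =
        (P.β / P.α) * √(n * Real.log (P.β / P.α)) / P.ε *
          (2 * √2 * n * P.α * P.ρ + √P.ε) ∧
      -- accuracy after `k + 1` iterations of the scheme
      (∀ X G U Y Z Uh : ℕ → Matrix (Fin n) (Fin n) ℝ, IsScheme P X G U Y Z Uh →
        ∀ k : ℕ, (iterBound (2 * √2) P ≤ k + 1 ∨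
            (P.ε ≤ (n * P.α * P.ρ) ^ 2 / 2 ∧ iterBound 1 P ≤ k + 1)) →
          objective P (Y k) - dualFun P (Uh k) ≤ P.ε ∧
          ∀ X' ∈ Q₁ P, objective P (Y k) ≤ objective P X' + P.ε) ∧
      -- termination, accuracy of the output, and total cost
      (∃ T : ℕ, StopsAfter (realMachine c) P T ∧
        T ≤ max 1 ⌈iterBound (2 * √2) P⌉₊ ∧
        (P.ε ≤ (n * P.α * P.ρ) ^ 2 / 2 → T ≤ max 1 ⌈iterBound 1 P⌉₊) ∧
        (runC (realMachine c) P T).val.Y ∈ Q₁ P ∧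
        (∀ X' ∈ Q₁ P, objective P (runC (realMachine c) P T).val.Y ≤ objective P X' + P.ε) ∧
        (runC (realMachine c) P T).cost ≤ C₀ * n ^ 3 * T)) ∧
    -- total complexity for fixed `α, β, ρ` and bounded `ε`
    (∀ α β ρ ε₀ : ℝ, 0 < α → α ≤ β → 0 < ρ → 0 < ε₀ →
      ∃ C : ℝ, ∀ (n : ℕ) (P : Data ℝ n), P.Valid → P.α = α → P.β = β → P.ρ = ρ → P.ε ≤ ε₀ →
        ∀ T : ℕ, StopsAfter (realMachine c) P T →
          ((runC (realMachine c) P T).cost : ℝ) ≤ C * (n : ℝ) ^ (9 / 2 : ℝ) / P.ε) := by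
  -- `6 * c + 150` for an iteration, and `4` for the initialization
  refine ⟨⟨6 * c + 154, fun n P hP => ?_⟩, fun α β ρ ε₀ hα hαβ hρ hε₀ => ?_⟩
  · have hα := hP.α_pos
    have hαβ := hP.α_le_β
    have hn := hP.dim_pos
    have hD₁ := D₁_eq hα hαβ
    have mono : ∀ {a b : ℕ}, a ≤ b * n ^ 3 → b ≤ 6 * c + 154 → a ≤ (6 * c + 154) * n ^ 3 :=
      fun h hb => h.trans (Nat.mul_le_mul_right _ hb)
    refine ⟨⟨hD₁ ▸ prox₁_isGreatest hα hαβ, hD₁, D₂_eq n ▸ prox₂_isGreatest n, D₂_eq n,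
      fun X hX X' hX' t ht => prox₁_strongConvex hα hX hX' ht,
      fun X hX => hasGradOnSymm_smoothPart hP hX,
      fun X hX X' hX' => smoothPart_grad_lipschitz hP hX hX'⟩,
      fun X hX => ⟨smoothed_le_objective hP (isSymm_of_mem_Q₁ hX),
        objective_le_smoothed hP (isSymm_of_mem_Q₁ hX)⟩,
      fun X hX X' hX' => gradForm_lipschitz hP hX hX',
      fun X hX => ⟨?_, isUniqueMinOn_clipU hP (isSymm_of_mem_Q₁ hX), hasGradOnSymm_smoothed hP hX,
        step1C_val c hα hX, mono (step1C_cost P c hn X) (by omega)⟩,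
      fun B V d h => isUniqueMinOn_proj hαβ h,
      fun X hX G hG => ⟨step2C_isUniqueMinOn c hP (isSymm_of_mem_Q₁ hX) hG,
        step2C_isUniqueMinOn_stepObj c hP (isSymm_of_mem_Q₁ hX) hG,
        mono (step2C_cost P c hn X G) (by omega)⟩,
      fun B V d h => isUniqueMinOn_prox hα hαβ h,
      fun W hW => ⟨step3C_isUniqueMinOn c hP hW, mono (step3C_cost P c hn W) (by omega)⟩,
      fun Y hY U hU => ⟨isLeast_dualFun hP hU.1, gapC_val c hP hY hU,
        mono (gapC_cost P c hn Y U) (by omega)⟩,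
      fun k s => mono (iterC_cost P c hn k s) (by omega),
      ⟨isScheme_runState c hP, runState_done_iff c hP⟩,
      iterBound_eq hP _, by rw [iterBound_eq hP, one_mul], ?_, ?_⟩
    · rw [smoothed_eq hP (isSymm_of_mem_Q₁ hX), smoothedPenalty_eq_huber hP]
    · intro X G U Y Z Uh h k hk
      have hgap := h.gap_le hP k (lipL_le_of_iterBound_le hP hk)
      exact ⟨hgap, fun C hC => h.accuracy hP k hgap hC⟩
    · obtain ⟨T, hT, hmin⟩ := exists_stopsAfter c hP
      exact ⟨T, hT, hmin _ (runState_done_of_iterBound c hP (Or.inl le_rfl)),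
        fun hε => hmin _ (runState_done_of_iterBound c hP (Or.inr ⟨hε, le_rfl⟩)),
        (runState_accuracy c hP hT).1, (runState_accuracy c hP hT).2,
        runC_cost_of_pos P c hn (one_le_of_stopsAfter c hT)⟩
  · refine ⟨(6 * c + 154) *
      ((β / α) * √(Real.log (β / α)) * (2 * √2 * α * ρ + 2 * √2 * √ε₀) + ε₀),
      fun n P hP h1 h2 h3 hε T hT => ?_⟩
    subst h1 h2 h3
    exact runC_cost_le c hP hε hT
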